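/- **Setting.** Let $(\mathcal C,\otimes,1)$ and $(\mathcal D,\otimes,1)$ be complete and cocomplete closed symmetric monoidal categories. Let $(\mathcal M,\boxtimes)$ be a left $\mathcal C$-actegory and $(\mathcal N,\boxplus)$ a left $\mathcal D$-actegory, with $\mathcal M,\mathcal N$ complete and cocomplete and with $\boxtimes$, $\boxplus$ preserving colimits in each variable. **Definitions.** They are given for $(\mathcal C,\mathcal M)$ and apply equally to $(\mathcal D,\mathcal N)$. Let $Comm(\mathcal C)$ be the category of commutative monoids in $\mathcal C$ and $Aff_{\mathcal C}=Comm(\mathcal C)^{op}$; write $Spec(a)$ for $a$ as an object of $Aff_{\mathcal C}$. For $a\in Comm(\mathcal C)$ let $Mod_{\mathcal M}(a)$ be the category of $a$-modules in $\mathcal M$, i.e. objects $m$ with an associative and unital action $a\boxtimes m\to m$. For $\alpha:a\to b$ in $Comm(\mathcal C)$ and $m\in Mod_{\mathcal M}(a)$, let $b\boxtimes_a m\in Mod_{\mathcal M}(b)$ be the coequalizer of the two maps $b\boxtimes(a\boxtimes m)\rightrightarrows b\boxtimes m$ given by the action on $m$ and by $\alpha$ followed by the multiplication of $b$. This defines a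 functor $\alpha^*=b\boxtimes_a-:Mod_{\mathcal M}(a)\to Mod_{\mathcal M}(b)$. * $\alpha$ is *$\mathcal M$-flat* if $\alpha^*$ preserves finite limits. It is *of finite type* if $\mathrm{Hom}(\alpha,-)$ on the coslice category $a/Comm(\mathcal C)$ preserves filtered colimits. $\alpha^{op}:Spec(b)\to Spec(a)$ is a *spectral immersion relative to $\mathcal M$* if $\alpha$ is an $\mathcal M$-flat epimorphism of finite type in $Comm(\mathcal C)$. * A family $\{\alpha_i^{op}:Spec(a_i)\to Spec(a)\}_{i\in I}$ is an *fpqc $\mathcal M$-cover* if every $\alpha_i$ is $\mathcal M$-flat and there is a finite $J\subseteq I$ for which the family $(\alpha_j^*)_{j\in J}$ is jointly conservative (a map $\varphi$ is an isomorphism as soon as all $\alpha_j^*(\varphi)$, $j\in J$, are). It is a *spectral $\mathcal M$-cover* if moreover every $\alpha_i^{op}$ is a spectral immersion relative to $\mathcal M$. These covers generate the fpqc and the spectral $\mathcal M$-topology on $Aff_{\mathcal C}$, and $Sh(Aff_{\mathcal C})_{\mathcal M}$ is the category of sheaves of sets for the spectral $\mathcal M$-topology. (Sets are taken in a universe in which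 $Aff_{\mathcal C}$ and $Aff_{\mathcal D}$ are small.) * $\mathcal M$ is *subcanonical* if all representable presheaves on $Aff_{\mathcal C}$ are sheaves for the fpqc $\mathcal M$-topology. In that case $Spec(a)$ is identified with the sheaf $Aff_{\mathcal C}(-,Spec(a))$. A subsheaf of an affine scheme $X$ is *Zariski open* if it is the image in $Sh(Aff_{\mathcal C})_{\mathcal M}$ of $\coprod_i X_i\to X$ for a family of spectral immersions $X_i\to X$ from affine schemes. A morphism $F\to G$ of sheaves is a *Zariski open immersion* if for every affine $X$ and every $X\to G$ the map $F\times_G X\to X$ is a monomorphism whose image is Zariski open in $X$. A sheaf $F$ is an *$\mathcal M$-scheme* if there are affine $X_i$ and Zariski open immersions $X_i\to F$ with $\coprod_i X_i\to F$ an epimorphism of sheaves. $Sch(\mathcal C)_{\mathcal M}$ is the full subcategory of $\mathcal M$-schemes. **Data.** Let $\mathbf B:\mathcal C\to\mathcal D$ be strong symmetric monoidal and left adjoint to $\mathbf A:\mathcal D\to\mathcal C$, where $\mathbf A$ preserves filtered colimits. With the induced lax symmetric monoidal structure on $\mathbf A$, both functors act on commutative monoids. Let $\mathbf B_*(\mathcal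 N)$ be the $\mathcal C$-actegory $\mathcal N$ with action $c\boxplus^{\mathbf B}n=\mathbf B(c)\boxplus n$. Let $(\mathbb L,\Gamma):\mathbf B_*(\mathcal N)\to\mathcal M$ be a lax $\mathcal C$-linear functor, $\Gamma_{c,n}:c\boxtimes\mathbb L(n)\to\mathbb L(\mathbf B(c)\boxplus n)$, which is conservative (reflects isomorphisms) and preserves finite limits. For $n\in Mod_{\mathcal N}(\mathbf B(a))$ regard $\mathbb L(n)$ as an $a$-module through $a\boxtimes\mathbb L(n)\xrightarrow{\Gamma_{a,n}}\mathbb L(\mathbf B(a)\boxplus n)\to\mathbb L(n)$. For $\alpha:a\to b$ in $Comm(\mathcal C)$, the composite $b\boxtimes\mathbb L(n)\xrightarrow{\Gamma_{b,n}}\mathbb L(\mathbf B(b)\boxplus n)\to\mathbb L(\mathbf B(b)\boxplus_{\mathbf B(a)}n)$ induces a canonical map in $Mod_{\mathcal M}(b)$, $$\theta_{\alpha,n}:b\boxtimes_a\mathbb L(n)\longrightarrow\mathbb L(\mathbf B(b)\boxplus_{\mathbf B(a)}n).$$ Assume that $\theta_{\alpha,n}$ is an isomorphism for every $\mathcal M$-flat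 $\alpha:a\to b$ and every $n\in Mod_{\mathcal N}(\mathbf B(a))$. **Theorem.** 1. The functor $\mathbf B^{op}:Aff_{\mathcal C}\to Aff_{\mathcal D}$ takes fpqc $\mathcal M$-covers to fpqc $\mathcal N$-covers. 2. Precomposition with $\mathbf B$ takes sheaves to sheaves, so that it restricts to a functor $\widetilde{\mathbf B}_!:Sh(Aff_{\mathcal D})_{\mathcal N}\to Sh(Aff_{\mathcal C})_{\mathcal M}$. This functor has a left adjoint $\widetilde{\mathbf A}_!:Sh(Aff_{\mathcal C})_{\mathcal M}\to Sh(Aff_{\mathcal D})_{\mathcal N}$, which sends $F$ to the sheafification, for the spectral $\mathcal N$-topology, of $F\circ\mathbf A$. 3. Suppose in addition that $\mathcal M$ and $\mathcal N$ are subcanonical. Then $\widetilde{\mathbf A}_!$ takes $\mathcal M$-schemes to $\mathcal N$-schemes, so that it restricts to a functor $Sch(\mathcal C)_{\mathcal M}\to Sch(\mathcal D)_{\mathcal N}$. For every $a\in Comm(\mathcal C)$ the canonical map $\widetilde{\mathbf A}_!(Spec(a))\to Spec(\mathbf B(a))=\mathbf B^{op}(Spec(a))$, which corresponds under the adjunction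 to $Spec(a)\to\widetilde{\mathbf B}_!(Spec(\mathbf B(a)))$, $f\mapsto\mathbf B^{op}(f)$, is an isomorphism. -/

import Mathlib

open CategoryTheory Limits MonoidalCategory MonoidalLeftAction MonObj Opposite

universe w t v u₁ u₂ u₃ u₄

namespace RelativeScheme

section Extension

variable {C : Type u₁} [Category.{v} C] [MonoidalCategory C] [BraidedCategory C]
variable {M : Type u₃} [Category.{v} M] [MonoidalLeftAction C M]

/-- The action of `C` on `M` preserves (small) colimits in each variable. -/
class CocontinuousAction (C : Type u₁) [Category.{v} C] [MonoidalCategory C]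
    (M : Type u₃) [Category.{v} M] [MonoidalLeftAction C M] : Prop where
  preservesColimits_left (c : C) : PreservesColimits (actionLeft M c)
  preservesColimits_right (m : M) : PreservesColimits (actionRight C m)

attribute [instance] CocontinuousAction.preservesColimits_left
  CocontinuousAction.preservesColimits_right

/-- The morphism of `C` underlying a morphism of commutative monoids. -/
abbrev homX {a b : CommMon C} (α : a ⟶ b) : a.X ⟶ b.X := (CommMon.forget C).map α

instance {a b : CommMon C} (α : a ⟶ b) : IsMonHom (homX α) :=
  inferInstanceAs (IsMonHom α.hom.hom)

variable {a b : CommMon C} (α : a ⟶ b) (m : Mod M a.X)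

/-- The map `b ⊠ (a ⊠ m) ⟶ b ⊠ m` given by the action of `a` on `m`. -/
def extFst (b : CommMon C) (m : Mod M a.X) : b.X ⊙ₗ a.X ⊙ₗ m.X ⟶ b.X ⊙ₗ m.X := b.X ⊴ₗ γ[a.X, m.X]

/-- The map `b ⊠ (a ⊠ m) ≅ (b ⊗ a) ⊠ m ⟶ b ⊠ m` given by the action of `a` on `b` along `α`. -/
def extSnd : b.X ⊙ₗ a.X ⊙ₗ m.X ⟶ b.X ⊙ₗ m.X :=
  (αₗ b.X a.X m.X).inv ≫ (b.X ◁ homX α ≫ μ[b.X]) ⊵ₗ m.X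

lemma mul_naturality {x y : M} (f : x ⟶ y) :
    b.X ⊴ₗ b.X ⊴ₗ f ≫ (αₗ b.X b.X y).inv ≫ μ[b.X] ⊵ₗ y =
      (αₗ b.X b.X x).inv ≫ μ[b.X] ⊵ₗ x ≫ b.X ⊴ₗ f := by
  rw [← action_exchange]
  simp

lemma extSnd_mul :
    b.X ⊴ₗ extSnd α m ≫ (αₗ b.X b.X m.X).inv ≫ μ[b.X] ⊵ₗ m.X =
      (αₗ b.X b.X (a.X ⊙ₗ m.X)).inv ≫ μ[b.X] ⊵ₗ (a.X ⊙ₗ m.X) ≫ extSnd α m := by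
  have h : (b.X ◁ (b.X ◁ homX α ≫ μ[b.X])) ≫ μ[b.X] =
      (α_ b.X b.X a.X).inv ≫ μ[b.X] ▷ a.X ≫ b.X ◁ homX α ≫ μ[b.X] := by
    rw [← whisker_exchange_assoc, MonObj.mul_assoc, MonoidalCategory.whiskerLeft_comp,
      Category.assoc, tensor_whiskerLeft]
    simp only [Category.assoc, Iso.inv_hom_id_assoc]
  have e : b.X ⊴ₗ (αₗ b.X a.X m.X).inv ≫ (αₗ b.X (b.X ⊗ a.X) m.X).inv =
      (αₗ b.X b.X (a.X ⊙ₗ m.X)).inv ≫ (αₗ (b.X ⊗ b.X) a.X m.X).inv ≫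
        (α_ b.X b.X a.X).hom ⊵ₗ m.X := by
    rw [← cancel_mono ((αₗ b.X (b.X ⊗ a.X) m.X).hom ≫ b.X ⊴ₗ (αₗ b.X a.X m.X).hom)]
    simp
  rw [extSnd, actionHomRight_comp, Category.assoc]
  have h1 : b.X ⊴ₗ (b.X ◁ homX α ≫ μ[b.X]) ⊵ₗ m.X ≫ (αₗ b.X b.X m.X).inv ≫ μ[b.X] ⊵ₗ m.X =
      (αₗ b.X (b.X ⊗ a.X) m.X).inv ≫ ((b.X ◁ (b.X ◁ homX α ≫ μ[b.X])) ≫ μ[b.X]) ⊵ₗ m.X := by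
    rw [comp_actionHomLeft (b.X ◁ (b.X ◁ homX α ≫ μ[b.X])), whiskerLeft_actionHomLeft]
    simp only [Category.assoc, Iso.inv_hom_id_assoc]
  rw [h1, h, reassoc_of% e, actionHomLeft_action]
  simp only [Category.assoc, Iso.hom_inv_id_assoc, ← comp_actionHomLeft, Iso.hom_inv_id_assoc]

variable [HasColimits M]

/-- The object `b ⊠_a m`, the coequalizer of the two maps `b ⊠ (a ⊠ m) ⇉ b ⊠ m`. -/
noncomputable def extX : M := coequalizer (extFst b m) (extSnd α m)

/-- The projection `b ⊠ m ⟶ b ⊠_a m`. -/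
noncomputable def extπ : b.X ⊙ₗ m.X ⟶ extX α m := coequalizer.π _ _

lemma ext_condition : extFst b m ≫ extπ α m = extSnd α m ≫ extπ α m := coequalizer.condition _ _

instance : Epi (extπ α m) := inferInstanceAs (Epi (coequalizer.π _ _))

variable [CocontinuousAction C M]

instance (c : C) : Epi (c ⊴ₗ extπ α m) :=
  inferInstanceAs (Epi ((actionLeft M c).map (extπ α m)))

lemma ext_mul_condition :
    b.X ⊴ₗ extFst b m ≫ (αₗ b.X b.X m.X).inv ≫ μ[b.X] ⊵ₗ m.X ≫ extπ α m =
      b.X ⊴ₗ extSnd α m ≫ (αₗ b.X b.X m.X).inv ≫ μ[b.X] ⊵ₗ m.X ≫ extπ α m := by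
  have h1 := mul_naturality (b := b) (γ[a.X, m.X])
  have h2 := extSnd_mul α m
  have h3 := ext_condition α m
  rw [extFst] at h3 ⊢
  rw [reassoc_of% h1, reassoc_of% h2, h3]

/-- The action of `b` on `b ⊠_a m`, induced by the multiplication of `b`. -/
noncomputable def extAct : b.X ⊙ₗ extX α m ⟶ extX α m :=
  Cofork.IsColimit.desc
    (isColimitOfHasCoequalizerOfPreservesColimit (actionLeft M b.X) (extFst b m) (extSnd α m))
    ((αₗ b.X b.X m.X).inv ≫ μ[b.X] ⊵ₗ m.X ≫ extπ α m) (ext_mul_condition α m)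

lemma extπ_act : b.X ⊴ₗ extπ α m ≫ extAct α m = (αₗ b.X b.X m.X).inv ≫ μ[b.X] ⊵ₗ m.X ≫ extπ α m :=
  Cofork.IsColimit.π_desc'
    (isColimitOfHasCoequalizerOfPreservesColimit (actionLeft M b.X) (extFst b m) (extSnd α m)) _ _

/-- The `b`-module structure of `b ⊠_a m`. -/
noncomputable instance extModObj : ModObj b.X (extX α m) where
  smul := extAct α m
  one_smul := by
    rw [← cancel_epi ((𝟙_ C) ⊴ₗ extπ α m), action_exchange_assoc, extπ_act,
      ← actionUnitIso_hom_naturality, actionHomLeft_action]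
    simp only [Category.assoc, Iso.hom_inv_id_assoc, ← comp_actionHomLeft_assoc, MonObj.one_mul]
    simp
  mul_smul := by
    rw [← cancel_epi ((b.X ⊗ b.X) ⊴ₗ extπ α m), action_exchange_assoc, extπ_act,
      tensor_actionHomRight]
    simp only [Category.assoc, Iso.inv_hom_id_assoc, ← actionHomRight_comp_assoc, extπ_act]
    have h : b.X ◁ μ[b.X] ≫ μ[b.X] = (α_ b.X b.X b.X).inv ≫ μ[b.X] ▷ b.X ≫ μ[b.X] := by simp
    have e : b.X ⊴ₗ (αₗ b.X b.X m.X).inv ≫ (αₗ b.X (b.X ⊗ b.X) m.X).inv =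
        (αₗ b.X b.X (b.X ⊙ₗ m.X)).inv ≫ (αₗ (b.X ⊗ b.X) b.X m.X).inv ≫
          (α_ b.X b.X b.X).hom ⊵ₗ m.X := by
      rw [← cancel_mono ((αₗ b.X (b.X ⊗ b.X) m.X).hom ≫ b.X ⊴ₗ (αₗ b.X b.X m.X).hom)]
      simp
    have h1 : b.X ⊴ₗ μ[b.X] ⊵ₗ m.X ≫ (αₗ b.X b.X m.X).inv ≫ μ[b.X] ⊵ₗ m.X =
        (αₗ b.X (b.X ⊗ b.X) m.X).inv ≫ ((b.X ◁ μ[b.X]) ≫ μ[b.X]) ⊵ₗ m.X := by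
      rw [comp_actionHomLeft, whiskerLeft_actionHomLeft]
      simp only [Category.assoc, Iso.inv_hom_id_assoc]
    simp only [actionHomRight_comp, Category.assoc, extπ_act]
    rw [reassoc_of% h1, h, reassoc_of% e, actionHomLeft_action]
    simp only [Category.assoc, Iso.hom_inv_id_assoc, ← comp_actionHomLeft_assoc]

/-- The `b`-module `b ⊠_a m`. -/
noncomputable def extMod : Mod M b.X where
  X := extX α m

variable {m} {m' : Mod M a.X}

/-- The map `b ⊠_a φ` on underlying objects. -/
noncomputable def extMapX (φ : m ⟶ m') : extX α m ⟶ extX α m' :=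
  coequalizer.desc (b.X ⊴ₗ φ.hom ≫ extπ α m') (by
    have h1 : extFst b m ≫ b.X ⊴ₗ φ.hom = b.X ⊴ₗ a.X ⊴ₗ φ.hom ≫ extFst b m' := by
      rw [extFst, extFst, ← actionHomRight_comp, ← actionHomRight_comp, IsModHom.smul_hom]
    have h2 : extSnd α m ≫ b.X ⊴ₗ φ.hom = b.X ⊴ₗ a.X ⊴ₗ φ.hom ≫ extSnd α m' := by
      rw [extSnd, extSnd, Category.assoc, ← action_exchange]
      simp only [tensor_actionHomRight, Category.assoc, Iso.inv_hom_id_assoc]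
    rw [reassoc_of% h1, reassoc_of% h2, ext_condition])

lemma extπ_map (φ : m ⟶ m') : extπ α m ≫ extMapX α φ = b.X ⊴ₗ φ.hom ≫ extπ α m' :=
  coequalizer.π_desc _ _

/-- The map `b ⊠_a φ` of `b`-modules. -/
noncomputable def extMap (φ : m ⟶ m') : extMod α m ⟶ extMod α m' :=
  Mod.Hom.mk' (extMapX α φ) (by
    change extAct α m ≫ extMapX α φ = b.X ⊴ₗ extMapX α φ ≫ extAct α m'
    rw [← cancel_epi (b.X ⊴ₗ extπ α m), reassoc_of% (extπ_act α m), extπ_map, ← actionHomRight_comp_assoc,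
      extπ_map, actionHomRight_comp_assoc, extπ_act, reassoc_of% (mul_naturality (b := b) φ.hom)])

variable (M) in
/-- Extension of scalars `b ⊠_a -` along `α : a ⟶ b`. -/
noncomputable def extFunctor : Mod M a.X ⥤ Mod M b.X where
  obj m := extMod α m
  map φ := extMap α φ
  map_id m := by
    ext
    change extMapX α (𝟙 m) = 𝟙 (extX α m)
    rw [← cancel_epi (extπ α m), extπ_map]
    simp
  map_comp φ ψ := by
    ext
    change extMapX α (φ ≫ ψ) = extMapX α φ ≫ extMapX α ψ
    rw [← cancel_epi (extπ α _), extπ_map, reassoc_of% (extπ_map α φ), extπ_map]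
    simp

end Extension

section BaseChange

variable {C : Type u₁} [Category.{v} C] [MonoidalCategory C] [BraidedCategory C]
variable {D : Type u₂} [Category.{v} D] [MonoidalCategory D] [BraidedCategory D]
variable {M : Type u₃} [Category.{v} M] [MonoidalLeftAction C M]
variable {N : Type u₄} [Category.{v} N] [MonoidalLeftAction D N]

open Functor.LaxMonoidal Functor.OplaxMonoidal

variable (N) in
/-- The `C`-actegory `B_*(N)`: `c` acts on `n` as `B c ⊞ n`. -/
@[reducible]
def restrictAction (B : C ⥤ D) [B.Monoidal] : MonoidalLeftAction C N where
  actionObj c n := B.obj c ⊙ₗ n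
  actionHomLeft f n := B.map f ⊵ₗ n
  actionHomRight c _ _ g := B.obj c ⊴ₗ g
  actionHom f g := B.map f ⊙ₗₘ g
  actionAssocIso c c' n :=
    { hom := δ B c c' ⊵ₗ n ≫ (αₗ (B.obj c) (B.obj c') n).hom
      inv := (αₗ (B.obj c) (B.obj c') n).inv ≫ Functor.LaxMonoidal.μ B c c' ⊵ₗ n
      hom_inv_id := by simp [← comp_actionHomLeft]
      inv_hom_id := by simp [← comp_actionHomLeft_assoc] }
  actionUnitIso n :=
    { hom := Functor.OplaxMonoidal.η B ⊵ₗ n ≫ (λₗ n).hom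
      inv := (λₗ n).inv ≫ ε B ⊵ₗ n
      hom_inv_id := by simp [← comp_actionHomLeft]
      inv_hom_id := by simp [← comp_actionHomLeft_assoc] }
  actionHom_def f g := by rw [actionHom_def]
  actionHomRight_id c n := by simp
  id_actionHomLeft c n := by simp
  actionHom_comp f₁ f₂ g₁ g₂ := by simp
  actionAssocIso_hom_naturality f g h := by
    dsimp
    have e : B.map (f ⊗ₘ g) ≫ δ B _ _ = δ B _ _ ≫ (B.map f ⊗ₘ B.map g) := by simp
    rw [actionHom_def', Category.assoc, ← comp_actionHomLeft_assoc, e, comp_actionHomLeft_assoc,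
      action_exchange_assoc, ← actionHom_def'_assoc, actionAssocIso_hom_naturality,
      Category.assoc]
  actionUnitIso_hom_naturality f := by
    dsimp
    rw [Category.assoc, actionUnitIso_hom_naturality, action_exchange_assoc]
  whiskerLeft_actionHomLeft c c' c'' f n := by
    have e : B.map (c ◁ f) = δ B _ _ ≫ (B.obj c ◁ B.map f) ≫ Functor.LaxMonoidal.μ B _ _ := by simp
    dsimp
    rw [e, comp_actionHomLeft, comp_actionHomLeft, whiskerLeft_actionHomLeft]
    simp only [Category.assoc]
  whiskerRight_actionHomLeft c'' f n := by
    have e : B.map (f ▷ c'') = δ B _ _ ≫ (B.map f ▷ B.obj c'') ≫ Functor.LaxMonoidal.μ B _ _ := by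
      simp
    dsimp
    rw [e, comp_actionHomLeft, comp_actionHomLeft, whiskerRight_actionHomLeft]
    simp only [Category.assoc]
  associator_actionHom c₁ c₂ c₃ n := by
    dsimp
    have e := oplax_associativity B c₁ c₂ c₃
    have e' := congrArg (fun f => f ⊵ₗ n ≫ (αₗ _ _ _).hom ≫ B.obj c₁ ⊴ₗ (αₗ _ _ _).hom) e
    simp only [comp_actionHomLeft, Category.assoc, associator_actionHom,
      whiskerLeft_actionHomLeft, whiskerRight_actionHomLeft, Iso.inv_hom_id_assoc] at e'
    simp only [actionHomRight_comp, Category.assoc, ← e']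
  leftUnitor_actionHom c n := by
    dsimp
    have e : B.map (λ_ c).hom = δ B _ _ ≫ Functor.OplaxMonoidal.η B ▷ B.obj c ≫
        (λ_ (B.obj c)).hom := by simp
    rw [e, comp_actionHomLeft, comp_actionHomLeft, leftUnitor_actionHom,
      whiskerRight_actionHomLeft]
    simp only [Category.assoc, Iso.inv_hom_id_assoc]
  rightUnitor_actionHom c n := by
    dsimp
    have e : B.map (ρ_ c).hom = δ B _ _ ≫ B.obj c ◁ Functor.OplaxMonoidal.η B ≫
        (ρ_ (B.obj c)).hom := by simp
    rw [e, comp_actionHomLeft, comp_actionHomLeft, rightUnitor_actionHom,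
      whiskerLeft_actionHomLeft, actionHomRight_comp]
    simp only [Category.assoc, Iso.inv_hom_id_assoc]

/-- A lax `C`-linear structure on `L : B_*(N) ⥤ M`. -/
abbrev LaxLinearAlong (B : C ⥤ D) [B.Monoidal] (L : N ⥤ M) :=
  @Functor.LaxLeftLinear N M _ _ L C _ _ (restrictAction N B) _

section

variable (B : C ⥤ D) [B.Braided] (L : N ⥤ M) [LaxLinearAlong B L]

/-- The structure map `Γ_{c,n} : c ⊠ L n ⟶ L (B c ⊞ n)`. -/
def lin (c : C) (n : N) : c ⊙ₗ L.obj n ⟶ L.obj (B.obj c ⊙ₗ n) :=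
  letI := restrictAction N B
  Functor.LaxLeftLinear.μₗ L c n

lemma lin_naturality_left {c c' : C} (f : c ⟶ c') (n : N) :
    f ⊵ₗ L.obj n ≫ lin B L c' n = lin B L c n ≫ L.map (B.map f ⊵ₗ n) :=
  letI := restrictAction N B
  Functor.LaxLeftLinear.μₗ_naturality_left L f n

lemma lin_naturality_right (c : C) {n n' : N} (g : n ⟶ n') :
    c ⊴ₗ L.map g ≫ lin B L c n' = lin B L c n ≫ L.map (B.obj c ⊴ₗ g) :=
  letI := restrictAction N B
  Functor.LaxLeftLinear.μₗ_naturality_right L c g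

lemma lin_assoc (c c' : C) (n : N) :
    lin B L (c ⊗ c') n ≫ L.map (δ B c c' ⊵ₗ n ≫ (αₗ (B.obj c) (B.obj c') n).hom) =
      (αₗ c c' (L.obj n)).hom ≫ c ⊴ₗ lin B L c' n ≫ lin B L c (B.obj c' ⊙ₗ n) :=
  letI := restrictAction N B
  Functor.LaxLeftLinear.μₗ_associativity L c c' n

lemma lin_assoc_inv {c c' d : C} (f : c ⊗ c' ⟶ d) (n : N) :
    (αₗ c c' (L.obj n)).inv ≫ f ⊵ₗ L.obj n ≫ lin B L d n =
      c ⊴ₗ lin B L c' n ≫ lin B L c (B.obj c' ⊙ₗ n) ≫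
        L.map ((αₗ (B.obj c) (B.obj c') n).inv ≫ (Functor.LaxMonoidal.μ B c c' ≫ B.map f) ⊵ₗ n) := by
  rw [Iso.inv_comp_eq, ← reassoc_of% (lin_assoc B L c c' n), ← L.map_comp, lin_naturality_left,
    comp_actionHomLeft]
  simp only [Category.assoc, Iso.hom_inv_id_assoc]
  rw [← comp_actionHomLeft_assoc, Functor.Monoidal.δ_μ, id_actionHomLeft, Category.id_comp]

lemma lin_unit (n : N) :
    (λₗ[C] (L.obj n)).hom = lin B L (𝟙_ C) n ≫ L.map (Functor.OplaxMonoidal.η B ⊵ₗ n ≫ (λₗ[D] n).hom) :=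
  letI := restrictAction N B
  Functor.LaxLeftLinear.μₗ_unitality L n


variable {a b : CommMon C} (α : a ⟶ b)

section

variable (n : Mod N (B.mapCommMon.obj a).X)

/-- The action map of the `B a`-module `n`, with the carrier of `B a` written as `B.obj a.X`. -/
def actB : B.obj a.X ⊙ₗ n.X ⟶ n.X := γ[(B.mapCommMon.obj a).X, n.X]

lemma actB_one : (ε B ≫ B.map η[a.X]) ⊵ₗ n.X ≫ actB B n = (λₗ[D] n.X).hom :=
  ModObj.one_smul (M := (B.mapCommMon.obj a).X) n.X

lemma actB_mul : (Functor.LaxMonoidal.μ B a.X a.X ≫ B.map μ[a.X]) ⊵ₗ n.X ≫ actB B n =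
    (αₗ (B.obj a.X) (B.obj a.X) n.X).hom ≫ B.obj a.X ⊴ₗ actB B n ≫ actB B n :=
  ModObj.mul_smul (M := (B.mapCommMon.obj a).X) n.X

lemma actB_hom {n n' : Mod N (B.mapCommMon.obj a).X} (φ : n ⟶ n') :
    actB B n ≫ φ.hom = B.obj a.X ⊴ₗ φ.hom ≫ actB B n' :=
  IsModHom.smul_hom (A := (B.mapCommMon.obj a).X) (f := φ.hom)

end

/-- The `a`-module `L n` of a `B a`-module `n`: the action is `a ⊠ L n ⟶ L (B a ⊞ n) ⟶ L n`. -/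
noncomputable def Lmod (n : Mod N (B.mapCommMon.obj a).X) : Mod M a.X where
  X := L.obj n.X
  mod :=
    { smul := lin B L a.X n.X ≫ L.map (actB B n)
      one_smul := by
        have h : Functor.OplaxMonoidal.η B ⊵ₗ n.X ≫ (λₗ[D] n.X).hom =
            B.map η[a.X] ⊵ₗ n.X ≫ actB B n := by
          rw [← actB_one B n, comp_actionHomLeft, Category.assoc, ← comp_actionHomLeft_assoc,
            Functor.Monoidal.η_ε, id_actionHomLeft, Category.id_comp]
        rw [reassoc_of% (lin_naturality_left B L), lin_unit B L, h, L.map_comp]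
      mul_smul := by
        have h : B.map μ[a.X] ⊵ₗ n.X ≫ actB B n =
            (δ B a.X a.X ⊵ₗ n.X ≫ (αₗ (B.obj a.X) (B.obj a.X) n.X).hom) ≫
              B.obj a.X ⊴ₗ actB B n ≫ actB B n := by
          rw [Category.assoc, ← actB_mul B n, comp_actionHomLeft, Category.assoc,
            ← comp_actionHomLeft_assoc, Functor.Monoidal.δ_μ, id_actionHomLeft, Category.id_comp]
        rw [reassoc_of% (lin_naturality_left B L), ← L.map_comp, h, L.map_comp,
          reassoc_of% (lin_assoc B L), L.map_comp, actionHomRight_comp, Category.assoc,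
          reassoc_of% (lin_naturality_right B L)] }

/-- The map of `a`-modules `L φ`. -/
noncomputable def LmodMap {n n' : Mod N (B.mapCommMon.obj a).X} (φ : n ⟶ n') :
    Lmod B L n ⟶ Lmod B L n' :=
  Mod.Hom.mk' (L.map φ.hom) (by
    change (lin B L a.X n.X ≫ L.map (actB B n)) ≫ L.map φ.hom =
      a.X ⊴ₗ L.map φ.hom ≫ lin B L a.X n'.X ≫ L.map (actB B n')
    rw [reassoc_of% (lin_naturality_right B L), Category.assoc, ← L.map_comp, ← L.map_comp,
      actB_hom])

variable (a) in
/-- The functor from `B a`-modules in `N` to `a`-modules in `M` induced by `L`. -/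
noncomputable def LmodFunctor : Mod N (B.mapCommMon.obj a).X ⥤ Mod M a.X where
  obj n := Lmod B L n
  map φ := LmodMap B L φ
  map_id n := by ext; exact L.map_id _
  map_comp φ ψ := by ext; exact L.map_comp _ _

variable [HasColimits M] [HasColimits N]

section

variable (n : Mod N (B.mapCommMon.obj a).X)

/-- The projection `B b ⊞ n ⟶ B b ⊞_{B a} n`. -/
noncomputable def extπB : B.obj b.X ⊙ₗ n.X ⟶ extX (B.mapCommMon.map α) n :=
  extπ (B.mapCommMon.map α) n

lemma extπB_condition : B.obj b.X ⊴ₗ actB B n ≫ extπB B α n =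
    (αₗ (B.obj b.X) (B.obj a.X) n.X).inv ≫
      (Functor.LaxMonoidal.μ B b.X a.X ≫ B.map (b.X ◁ homX α ≫ μ[b.X])) ⊵ₗ n.X ≫
        extπB B α n := by
  have h := ext_condition (B.mapCommMon.map α) n
  have e : (αₗ (B.obj b.X) (B.obj a.X) n.X).inv ≫
      (Functor.LaxMonoidal.μ B b.X a.X ≫ B.map (b.X ◁ homX α ≫ μ[b.X])) ⊵ₗ n.X =
      extSnd (B.mapCommMon.map α) n := by
    have e' : Functor.LaxMonoidal.μ B b.X a.X ≫ B.map (b.X ◁ homX α ≫ μ[b.X]) =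
        B.obj b.X ◁ B.map (homX α) ≫ Functor.LaxMonoidal.μ B b.X b.X ≫ B.map μ[b.X] := by
      rw [Functor.map_comp, μ_natural_right_assoc]
    rw [e']
    rfl
  rw [reassoc_of% e]
  exact h

/-- The action of `B b` on `B b ⊞_{B a} n`. -/
noncomputable def extActB [CocontinuousAction D N] :
    B.obj b.X ⊙ₗ extX (B.mapCommMon.map α) n ⟶ extX (B.mapCommMon.map α) n :=
  extAct (B.mapCommMon.map α) n

lemma extπB_act [CocontinuousAction D N] :
    B.obj b.X ⊴ₗ extπB B α n ≫ extActB B α n =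
      (αₗ (B.obj b.X) (B.obj b.X) n.X).inv ≫
        (Functor.LaxMonoidal.μ B b.X b.X ≫ B.map μ[b.X]) ⊵ₗ n.X ≫ extπB B α n :=
  extπ_act (B.mapCommMon.map α) n

lemma theta_condition :
    b.X ⊴ₗ (lin B L a.X n.X ≫ L.map (actB B n)) ≫ lin B L b.X n.X ≫ L.map (extπB B α n) =
      ((αₗ b.X a.X (L.obj n.X)).inv ≫ (b.X ◁ homX α ≫ μ[b.X]) ⊵ₗ (L.obj n.X)) ≫
        lin B L b.X n.X ≫ L.map (extπB B α n) := by
  rw [actionHomRight_comp, Category.assoc, Category.assoc, reassoc_of% (lin_assoc_inv B L),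
    reassoc_of% (lin_naturality_right B L), ← L.map_comp, extπB_condition, ← L.map_comp]
  simp only [Category.assoc]

end

/-- The map `b ⊠_a L n ⟶ L (B b ⊞_{B a} n)` induced by
`b ⊠ L n ⟶ L (B b ⊞ n) ⟶ L (B b ⊞_{B a} n)`. -/
noncomputable def thetaX (n : Mod N (B.mapCommMon.obj a).X) :
    extX α (Lmod B L n) ⟶ L.obj (extX (B.mapCommMon.map α) n) :=
  coequalizer.desc (lin B L b.X n.X ≫ L.map (extπB B α n)) (theta_condition B L α n)

lemma extπ_thetaX (n : Mod N (B.mapCommMon.obj a).X) :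
    extπ α (Lmod B L n) ≫ thetaX B L α n = lin B L b.X n.X ≫ L.map (extπB B α n) :=
  coequalizer.π_desc _ _

variable [CocontinuousAction C M] [CocontinuousAction D N]

lemma theta_act_aux (n : Mod N (B.mapCommMon.obj a).X) :
    (αₗ b.X b.X (L.obj n.X)).inv ≫ μ[b.X] ⊵ₗ L.obj n.X ≫ lin B L b.X n.X ≫ L.map (extπB B α n) =
      b.X ⊴ₗ (lin B L b.X n.X ≫ L.map (extπB B α n)) ≫
        lin B L b.X (extX (B.mapCommMon.map α) n) ≫ L.map (extActB B α n) := by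
  rw [reassoc_of% (lin_assoc_inv B L), actionHomRight_comp, Category.assoc,
    reassoc_of% (lin_naturality_right B L), ← L.map_comp, ← L.map_comp, extπB_act]
  simp only [Category.assoc]

lemma thetaX_act (n : Mod N (B.mapCommMon.obj a).X) :
    extAct α (Lmod B L n) ≫ thetaX B L α n = b.X ⊴ₗ thetaX B L α n ≫
      lin B L b.X (extX (B.mapCommMon.map α) n) ≫ L.map (extActB B α n) := by
  rw [← cancel_epi (b.X ⊴ₗ extπ α (Lmod B L n)), reassoc_of% (extπ_act α (Lmod B L n)),
    extπ_thetaX, ← actionHomRight_comp_assoc, extπ_thetaX]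
  exact theta_act_aux B L α n

/-- The canonical map `b ⊠_a L n ⟶ L (B b ⊞_{B a} n)` as a map of `b`-modules. -/
noncomputable def theta (n : Mod N (B.mapCommMon.obj a).X) :
    extMod α (Lmod B L n) ⟶ Lmod B L (extMod (B.mapCommMon.map α) n) :=
  Mod.Hom.mk' (thetaX B L α n) (thetaX_act B L α n)

end
end BaseChange

section Topology

/-- The category of affine schemes over `C`. -/
abbrev Aff (C : Type u₁) [Category.{v} C] [MonoidalCategory C] [BraidedCategory C] :=
  (CommMon C)ᵒᵖ

variable {C : Type u₁} [Category.{v} C] [MonoidalCategory C] [BraidedCategory C]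
variable (M : Type u₃) [Category.{v} M] [MonoidalLeftAction C M]
  [HasColimits M] [CocontinuousAction C M]

/-- `α` is `M`-flat: extension of scalars of modules in `M` along `α` preserves finite limits. -/
def IsFlat {a b : CommMon C} (α : a ⟶ b) : Prop :=
  PreservesFiniteLimits (extFunctor M α)

/-- `α : a ⟶ b` is of finite type: `b` is a finitely presented object of the category of commutative
monoids under `a`. -/
def IsFiniteType {a b : CommMon C} (α : a ⟶ b) : Prop :=
  PreservesFilteredColimits (coyoneda.obj (op (Under.mk α)))

/-- An fpqc `M`-cover: all members are `M`-flat, and finitely many of the extension functors are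
jointly conservative. -/
structure IsFpqcCover {I : Type t} {X : Aff C} (Y : I → Aff C) (f : ∀ i, Y i ⟶ X) : Prop where
  flat (i : I) : IsFlat M (f i).unop
  conservative : ∃ J : Finset I, ∀ {m m' : Mod M X.unop.X} (φ : m ⟶ m'),
    (∀ j ∈ J, IsIso ((extFunctor M (f j).unop).map φ)) → IsIso φ

/-- A spectral `M`-immersion: the map of monoids is an `M`-flat epimorphism of finite type. -/
structure IsSpectralImmersion {X Y : Aff C} (f : Y ⟶ X) : Prop where
  flat : IsFlat M f.unop
  epi : Epi f.unop
  finiteType : IsFiniteType f.unop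

/-- A spectral `M`-cover: an fpqc `M`-cover by spectral `M`-immersions. -/
structure IsSpectralCover {I : Type t} {X : Aff C} (Y : I → Aff C) (f : ∀ i, Y i ⟶ X) : Prop where
  isFpqcCover : IsFpqcCover M Y f
  isSpectralImmersion (i : I) : IsSpectralImmersion M (f i)

variable (C)

/-- The fpqc `M`-covers. -/
def fpqcPrecoverage : Precoverage (Aff C) where
  coverings X := {R | ∃ (I : Type (max u₁ v)) (Y : I → Aff C) (f : ∀ i, Y i ⟶ X),
    IsFpqcCover M Y f ∧ R = Presieve.ofArrows Y f}

/-- The spectral `M`-covers. -/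
def spectralPrecoverage : Precoverage (Aff C) where
  coverings X := {R | ∃ (I : Type (max u₁ v)) (Y : I → Aff C) (f : ∀ i, Y i ⟶ X),
    IsSpectralCover M Y f ∧ R = Presieve.ofArrows Y f}

/-- The topology generated by the fpqc `M`-covers. -/
def fpqcTopology : GrothendieckTopology (Aff C) := (fpqcPrecoverage C M).toGrothendieck

/-- The topology generated by the spectral `M`-covers. -/
def spectralTopology : GrothendieckTopology (Aff C) := (spectralPrecoverage C M).toGrothendieck

lemma spectralTopology_le_fpqcTopology : spectralTopology C M ≤ fpqcTopology C M := by
  rw [spectralTopology, Precoverage.toGrothendieck_eq_sInf]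
  refine sInf_le ?_
  rintro X _ ⟨I, Y, f, hf, rfl⟩
  exact Precoverage.generate_mem_toGrothendieck ⟨I, Y, f, hf.isFpqcCover, rfl⟩

/-- `M` is subcanonical: representable presheaves are sheaves for the fpqc `M`-topology. -/
abbrev IsSubcanonical : Prop := (fpqcTopology C M).Subcanonical

instance [IsSubcanonical C M] : (spectralTopology C M).Subcanonical :=
  GrothendieckTopology.Subcanonical.of_le (spectralTopology_le_fpqcTopology C M)

/-- Sheaves of sets on `Aff C` for the spectral `M`-topology, with values in a universe of sets in
which `Aff C` is small. -/
abbrev Sh := Sheaf (spectralTopology C M) (Type (max w u₁ v))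

noncomputable instance (I : Type (max w u₁ v)) :
    HasColimitsOfShape (Discrete I) (Sh.{w} C M) :=
  Sheaf.instHasColimitsOfShape

end Topology

section Schemes

variable {C : Type u₁} [Category.{v} C] [MonoidalCategory C] [BraidedCategory C]
variable (M : Type u₃) [Category.{v} M] [MonoidalLeftAction C M]
  [HasColimits M] [CocontinuousAction C M] [IsSubcanonical C M]

/-- The embedding of affine schemes into sheaves, by their functors of points. -/
noncomputable abbrev affine : Aff C ⥤ Sh.{w} C M :=
  GrothendieckTopology.uliftYoneda.{max w u₁} (spectralTopology C M)

variable {M}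

/-- A subobject of an affine scheme is Zariski open if it is the image of a coproduct of affine schemes
mapping to it by spectral immersions. -/
def IsZariskiOpen {X : Aff C} (F : Subobject ((affine.{w} M).obj X)) : Prop :=
  ∃ (I : Type (max w u₁ v)) (Y : I → Aff C) (f : ∀ i, Y i ⟶ X)
    (p : (∐ fun i => (affine.{w} M).obj (Y i)) ⟶ (F : Sh.{w} C M)),
    (∀ i, IsSpectralImmersion M (f i)) ∧ Epi p ∧
      p ≫ F.arrow = Sigma.desc fun i => (affine.{w} M).map (f i)

/-- A Zariski open immersion: its base change to any affine scheme is a monomorphism onto a Zariski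
open subobject. -/
def IsZariskiOpenImmersion {F G : Sh.{w} C M} (f : F ⟶ G) : Prop :=
  ∀ (X : Aff C) (g : (affine.{w} M).obj X ⟶ G),
    ∃ _ : Mono (pullback.snd f g), IsZariskiOpen (Subobject.mk (pullback.snd f g))

/-- An `M`-scheme: a sheaf with an epimorphism from a coproduct of affine schemes, each of whose
components is a Zariski open immersion. -/
def IsScheme (F : Sh.{w} C M) : Prop :=
  ∃ (I : Type (max w u₁ v)) (X : I → Aff C) (f : ∀ i, (affine.{w} M).obj (X i) ⟶ F),
    (∀ i, IsZariskiOpenImmersion (f i)) ∧ Epi (Sigma.desc f)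

end Schemes

section Comparison

open Functor.LaxMonoidal Functor.OplaxMonoidal

variable {C : Type u₁} [Category.{v} C] [MonoidalCategory C] [BraidedCategory C]
variable {D : Type u₂} [Category.{v} D] [MonoidalCategory D] [BraidedCategory D]
variable (M : Type u₃) [Category.{v} M] [MonoidalLeftAction C M]
  [HasColimits M] [CocontinuousAction C M]
variable (N : Type u₄) [Category.{v} N] [MonoidalLeftAction D N]
  [HasColimits N] [CocontinuousAction D N]
variable {B : C ⥤ D} [B.Braided] {A : D ⥤ C} (adj : B ⊣ A)

/-- The lax symmetric monoidal structure on the right adjoint of a strong symmetric monoidal functor. -/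
@[reducible]
def rightAdjointLaxBraided : A.LaxBraided :=
  letI := adj.rightAdjointLaxMonoidal
  { braided := fun X Y => by
      change adj.homEquiv _ _ (δ B _ _ ≫ (adj.counit.app X ⊗ₘ adj.counit.app Y)) ≫
          A.map (β_ X Y).hom =
        (β_ (A.obj X) (A.obj Y)).hom ≫
          adj.homEquiv _ _ (δ B _ _ ≫ (adj.counit.app Y ⊗ₘ adj.counit.app X))
      rw [← adj.homEquiv_naturality_right, ← adj.homEquiv_naturality_left, Functor.map_braiding]
      simp }

variable (B) in
/-- The functor `B^op : Aff C ⥤ Aff D`. -/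
abbrev Bop : Aff C ⥤ Aff D := B.mapCommMon.op

/-- The functor `A^op : Aff D ⥤ Aff C`, for the lax symmetric monoidal structure of the right adjoint. -/
def Aop : Aff D ⥤ Aff C :=
  letI := rightAdjointLaxBraided adj
  A.mapCommMon.op

/-- A sheaf is precomposed with `A` and then sheafified. -/
noncomputable def ATilde : Sh.{u₂} C M ⥤ Sh.{u₁} D N :=
  sheafToPresheaf (spectralTopology C M) (Type (max u₁ u₂ v)) ⋙
    (Functor.whiskeringLeft _ _ _).obj (Aop adj).op ⋙
      presheafToSheaf (spectralTopology D N) (Type (max u₁ u₂ v))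

variable (B) in
/-- Precomposition with `B`, as a functor between categories of sheaves. -/
def BTilde [(Bop B).IsContinuous (spectralTopology C M) (spectralTopology D N)] :
    Sh.{u₁} D N ⥤ Sh.{u₂} C M :=
  (Bop B).sheafPushforwardContinuous (Type (max u₁ u₂ v)) _ _

variable (B) in
/-- The canonical map from `Spec a` to the precomposition of `Spec (B a)` with `B`, given by `f ↦ B f`. -/
def affineUnit [(Bop B).IsContinuous (spectralTopology C M) (spectralTopology D N)]
    [IsSubcanonical C M] [IsSubcanonical D N] (X : Aff C) :
    (affine.{u₂} M).obj X ⟶ (BTilde M N B).obj ((affine.{u₁} N).obj ((Bop B).obj X)) where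
  hom := { app Y := ↾fun f => ULift.up ((Bop B).map f.down)
           naturality Y Z g := by
             ext f
             exact congrArg ULift.up ((Bop B).map_comp g.unop f.down) }

end Comparison

end RelativeScheme

open RelativeScheme

/-! The core is a fact about modules. Finite limits and isomorphisms of modules are detected on
underlying objects, so `LmodFunctor` inherits from `L` that it is left exact and conservative. For
flat `α : a ⟶ b` the maps `theta` identify `b ⊠_a L(-)` with `L(B(b) ⊞_{B(a)} -)` (`thetaIso`). The
first functor is left exact and `LmodFunctor` reflects finite limits, so `B(α)` is `N`-flat
(`isFlat_map`). If the extensions along all `B(α_j)` invert `φ`, then the extensions along all `α_j`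
invert `L(φ)`, and joint conservativity followed by conservativity of `L` shows that `φ` is
invertible (`IsFpqcCover.map`).

On commutative monoids `B` is left adjoint to `A`, so it preserves epimorphisms. Filtered colimits
of commutative monoids are computed on underlying objects, so `A` preserves them there too, and
hence `B` preserves finite type (`IsFiniteType.map`). Thus spectral immersions and spectral covers
are preserved. As `B^op` is a right adjoint, it is then continuous for the generated topologies
(`coverPreserving_Bop`). Precomposition with `A` is left adjoint to precomposition with `B` on
presheaves; sheafifying gives the adjunction on sheaves. On an affine scheme `X` the bijection
`Hom(A^op Z, X) ≅ Hom(Z, B^op X)` shows that the presheaf is already representable, hence a sheaf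
(`isIso_affineUnit`).

For schemes, the left adjoint on sheaves is also left exact and extends `B^op`, so it preserves
jointly epimorphic families, monomorphisms and the intersections `X_i ×_F X_j`. The difficulty is
openness over an affine `X'` that need not come from `C`. Locally on `X'`, along spectral
immersions, the map from `X'` lifts to some `B^op X_j`, and there the subobject is pulled back from
the open subobject `X_i ×_F X_j` of `X_j` (`IsZariskiOpenImmersion.mapAffine`). This needs spectral
immersions to be stable under composition and base change, and every covering sieve to contain one
generated by spectral immersions (`spectralPart_mem`). For base change, the pushout `b ⊗_a c` is
built as a reflexive coequalizer, which the forgetful functor preserves, and `b ⊠_a m ≅ (b ⊗_a c)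
⊠_c m` (`baseChangeIso`) carries flatness across. -/

namespace RelativeScheme

/-! ### Limits of modules -/

section ModuleLimits

variable {C : Type u₁} [Category.{v} C] [MonoidalCategory C]
variable {M : Type u₃} [Category.{v} M] [MonoidalLeftAction C M]
variable {a : C} [MonObj a] {J : Type w} [Category.{t} J]

instance : (Mod.forget (D := M) a).ReflectsIsomorphisms where
  reflects {m n} f hf := by
    have : IsIso f.hom := hf
    refine ⟨Mod.Hom.mk' (inv f.hom) ?_, ?_, ?_⟩
    · rw [IsIso.comp_inv_eq, Category.assoc, IsModHom.smul_hom, ← actionHomRight_comp_assoc,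
        IsIso.inv_hom_id, actionHomRight_id, Category.id_comp]
    · ext; exact IsIso.hom_inv_id f.hom
    · ext; exact IsIso.inv_hom_id f.hom

section

variable {F : J ⥤ Mod M a} (c : Cone (F ⋙ Mod.forget a))

/-- A projection of a cone over the underlying objects of a diagram of modules. -/
def modProj (j : J) : c.pt ⟶ (F.obj j).X := c.π.app j

lemma modProj_w {i j : J} (f : i ⟶ j) : modProj c i ≫ (F.map f).hom = modProj c j := c.w f

/-- The cone with vertex `a ⊙ c` whose lift is the action on the limit `c` of a diagram of modules. -/
def actCone : Cone (F ⋙ Mod.forget a) where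
  pt := a ⊙ₗ c.pt
  π :=
    { app j := a ⊴ₗ modProj c j ≫ γ[a, (F.obj j).X]
      naturality i j f := by
        change 𝟙 _ ≫ a ⊴ₗ modProj c j ≫ γ[a, (F.obj j).X] =
          (a ⊴ₗ modProj c i ≫ γ[a, (F.obj i).X]) ≫ (F.map f).hom
        rw [Category.id_comp, Category.assoc, IsModHom.smul_hom, ← actionHomRight_comp_assoc,
          modProj_w] }

variable {c}

lemma modProj_hom_ext (hc : IsLimit c) {x : M} {f g : x ⟶ c.pt} (h : ∀ j, f ≫ modProj c j = g ≫ modProj c j) :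
    f = g := hc.hom_ext h

variable (hc : IsLimit c)

/-- The action on the limit of the underlying objects of a diagram of modules. -/
def limitAct : a ⊙ₗ c.pt ⟶ c.pt := hc.lift (actCone c)

lemma limitAct_proj (j : J) :
    limitAct hc ≫ modProj c j = a ⊴ₗ modProj c j ≫ γ[a, (F.obj j).X] := hc.fac (actCone c) j

/-- The module structure on the limit of the underlying objects of a diagram of modules. -/
@[reducible]
def limitModObj : ModObj a c.pt where
  smul := limitAct hc
  one_smul := modProj_hom_ext hc fun j => by
    rw [Category.assoc, limitAct_proj, ← action_exchange_assoc, ModObj.one_smul,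
      ← actionUnitIso_hom_naturality]
  mul_smul := modProj_hom_ext hc fun j => by
    simp only [Category.assoc, limitAct_proj]
    rw [← action_exchange_assoc, ModObj.mul_smul, ← actionHomRight_comp_assoc, limitAct_proj]
    simp

/-- The limit of a diagram of modules, built on the limit of the underlying objects. -/
def limitMod : Mod M a :=
  letI := limitModObj hc
  ⟨c.pt⟩

/-- The limit cone of a diagram of modules, built on the limit of the underlying objects. -/
def limitModCone : Cone F where
  pt := limitMod hc
  π :=
    { app j := Mod.Hom.mk' (modProj c j) (limitAct_proj hc j)
      naturality i j f := by
        ext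
        exact c.π.naturality f }

/-- The lift of a cone of modules to the limit of the underlying objects. -/
def limitModLift (s : Cone F) : s.pt.X ⟶ c.pt := hc.lift ((Mod.forget a).mapCone s)

lemma limitModLift_proj (s : Cone F) (j : J) :
    limitModLift hc s ≫ modProj c j = (s.π.app j).hom := hc.fac ((Mod.forget a).mapCone s) j

/-- `limitModCone` is a limit cone. -/
def limitModConeIsLimit : IsLimit (limitModCone hc) where
  lift s := Mod.Hom.mk' (limitModLift hc s) (modProj_hom_ext hc fun j => by
    change (γ[a, s.pt.X] ≫ limitModLift hc s) ≫ modProj c j =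
      (a ⊴ₗ limitModLift hc s ≫ limitAct hc) ≫ modProj c j
    rw [Category.assoc, limitModLift_proj, Category.assoc, limitAct_proj,
      ← actionHomRight_comp_assoc, limitModLift_proj]
    exact IsModHom.smul_hom (f := (s.π.app j).hom))
  fac s j := by
    ext
    exact hc.fac _ j
  uniq s m h := by
    ext
    exact hc.uniq ((Mod.forget a).mapCone s) m.hom fun j => congrArg Mod.Hom.hom (h j)

end

noncomputable instance : CreatesLimitsOfShape J (Mod.forget (D := M) a) where
  CreatesLimit := createsLimitOfReflectsIso fun _ hc =>
    { liftedCone := limitModCone hc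
      validLift := Cone.ext (Iso.refl _) fun _ => (Category.id_comp _).symm
      makesLimit := limitModConeIsLimit hc }

instance [HasFiniteLimits M] : HasFiniteLimits (Mod M a) :=
  ⟨fun _ _ _ => hasLimitsOfShape_of_hasLimitsOfShape_createsLimitsOfShape (Mod.forget a)⟩

instance [HasFiniteLimits M] : PreservesFiniteLimits (Mod.forget (D := M) a) :=
  ⟨fun _ _ _ => inferInstance⟩

/-- A functor to modules preserves finite limits if it does so on underlying objects. -/
lemma preservesFiniteLimits_iff_comp_forget {X : Type*} [Category X] [HasFiniteLimits M]
    (F : X ⥤ Mod M a) :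
    PreservesFiniteLimits F ↔ PreservesFiniteLimits (F ⋙ Mod.forget a) :=
  ⟨fun _ => comp_preservesFiniteLimits _ _, fun h => ⟨fun J _ _ =>
    have := h.preservesFiniteLimits J
    preservesLimitsOfShape_of_reflects_of_preserves F (Mod.forget a)⟩⟩

end ModuleLimits

/-! ### Extension and restriction of scalars -/

section Adjunction

variable {C : Type u₁} [Category.{v} C] [MonoidalCategory C] [BraidedCategory C]
variable {M : Type u₃} [Category.{v} M] [MonoidalLeftAction C M]
variable {a b : CommMon C} (α : a ⟶ b)

/-- The action of `a` on a `b`-module by restriction of scalars along `α : a ⟶ b`. -/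
def resAct (n : Mod M b.X) : a.X ⊙ₗ n.X ⟶ n.X := homX α ⊵ₗ n.X ≫ γ[b.X, n.X]

/-- Associativity of the `b`-action. This balance over `a` is what lets maps out of `b ⊠ m` descend
to `b ⊠_a m` in `extDesc`. -/
lemma whisker_resAct_act (n : Mod M b.X) :
    b.X ⊴ₗ resAct α n ≫ γ[b.X, n.X] =
      (αₗ b.X a.X n.X).inv ≫ (b.X ◁ homX α ≫ μ[b.X]) ⊵ₗ n.X ≫ γ[b.X, n.X] := by
  rw [resAct, actionHomRight_comp, Category.assoc, ModObj.assoc_flip, comp_actionHomLeft,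
    whiskerLeft_actionHomLeft]
  simp only [Category.assoc, Iso.inv_hom_id_assoc]

variable (M) in
/-- Restriction of scalars along `α : a ⟶ b`. -/
abbrev restrict : Mod M b.X ⥤ Mod M a.X := Mod.comap (homX α)

lemma restrict_hom {m : Mod M a.X} {n : Mod M b.X} (f : m ⟶ (restrict M α).obj n) :
    γ[a.X, m.X] ≫ f.hom = a.X ⊴ₗ f.hom ≫ resAct α n :=
  IsModHom.smul_hom (f := f.hom)

instance [HasFiniteLimits M] : PreservesFiniteLimits (restrict M α) := by
  rw [preservesFiniteLimits_iff_comp_forget]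
  exact inferInstanceAs (PreservesFiniteLimits (Mod.forget (D := M) b.X))

variable [HasColimits M]

/-- The unit `m ⟶ b ⊠_a m` of extension of scalars. -/
noncomputable def extUnit (m : Mod M a.X) : m.X ⟶ extX α m :=
  (λₗ m.X).inv ≫ η[b.X] ⊵ₗ m.X ≫ extπ α m

/-- This is the coequalizer relation precomposed with the unit of `b`: the first of the two maps
becomes the action on `m`, the second becomes `α`. -/
lemma act_extUnit (m : Mod M a.X) : γ[a.X, m.X] ≫ extUnit α m = homX α ⊵ₗ m.X ≫ extπ α m := by
  have h1 : γ[a.X, m.X] ≫ (λₗ m.X).inv ≫ η[b.X] ⊵ₗ m.X =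
      (λₗ (a.X ⊙ₗ m.X)).inv ≫ η[b.X] ⊵ₗ (a.X ⊙ₗ m.X) ≫ extFst b m := by
    rw [extFst, ← action_exchange, ← cancel_epi (λₗ[C] (a.X ⊙ₗ m.X)).hom, Iso.hom_inv_id_assoc,
      reassoc_of% (actionUnitIso_hom_naturality (C := C) γ[a.X, m.X]), Iso.hom_inv_id_assoc]
  have h2 : (λₗ (a.X ⊙ₗ m.X)).inv ≫ η[b.X] ⊵ₗ (a.X ⊙ₗ m.X) ≫ extSnd α m = homX α ⊵ₗ m.X := by
    have e : η[b.X] ⊵ₗ (a.X ⊙ₗ m.X) ≫ (αₗ b.X a.X m.X).inv =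
        (αₗ (𝟙_ C) a.X m.X).inv ≫ (η[b.X] ▷ a.X) ⊵ₗ m.X := by
      rw [whiskerRight_actionHomLeft, Iso.inv_hom_id_assoc]
    have e' : η[b.X] ▷ a.X ≫ b.X ◁ homX α ≫ μ[b.X] = (λ_ a.X).hom ≫ homX α := by
      rw [← whisker_exchange_assoc, MonObj.one_mul, leftUnitor_naturality]
    rw [extSnd, Iso.inv_comp_eq, reassoc_of% e, ← comp_actionHomLeft, e', comp_actionHomLeft,
      leftUnitor_actionHom, Category.assoc, Iso.inv_hom_id_assoc]
  rw [extUnit, reassoc_of% h1, ext_condition, reassoc_of% h2]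

variable [CocontinuousAction C M]

/-- Multiplying by the unit of `b` changes nothing. Consequently a `b`-linear map out of `b ⊠_a m`
is determined by its restriction along `extUnit`. -/
lemma whisker_extUnit_act (m : Mod M a.X) :
    b.X ⊴ₗ extUnit α m ≫ extAct α m = extπ α m := by
  rw [extUnit, actionHomRight_comp, actionHomRight_comp, Category.assoc, Category.assoc, extπ_act]
  have e : b.X ⊴ₗ η[b.X] ⊵ₗ m.X ≫ (αₗ b.X b.X m.X).inv =
      (αₗ b.X (𝟙_ C) m.X).inv ≫ (b.X ◁ η[b.X]) ⊵ₗ m.X := by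
    rw [whiskerLeft_actionHomLeft, Iso.inv_hom_id_assoc]
  rw [reassoc_of% e, ← comp_actionHomLeft_assoc, MonObj.mul_one, rightUnitor_actionHom,
    Category.assoc, Iso.inv_hom_id_assoc, ← actionHomRight_comp_assoc, Iso.inv_hom_id,
    actionHomRight_id, Category.id_comp]

lemma act_extUnit' (m : Mod M a.X) :
    γ[a.X, m.X] ≫ extUnit α m = a.X ⊴ₗ extUnit α m ≫ homX α ⊵ₗ extX α m ≫ extAct α m := by
  rw [action_exchange_assoc, whisker_extUnit_act, act_extUnit]

section

variable {m : Mod M a.X} {n : Mod M b.X} (f : m.X ⟶ n.X)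
  (hf : γ[a.X, m.X] ≫ f = a.X ⊴ₗ f ≫ resAct α n)

/-- The map `b ⊠_a m ⟶ n` corresponding to an `a`-linear map `m ⟶ n`. -/
noncomputable def extDesc : extX α m ⟶ n.X :=
  coequalizer.desc (b.X ⊴ₗ f ≫ γ[b.X, n.X]) (by
    rw [extFst, ← actionHomRight_comp_assoc, hf, actionHomRight_comp_assoc, whisker_resAct_act,
      extSnd, Category.assoc, ← action_exchange_assoc, tensor_actionHomRight]
    simp only [Category.assoc, Iso.inv_hom_id_assoc])

lemma extπ_desc : extπ α m ≫ extDesc α f hf = b.X ⊴ₗ f ≫ γ[b.X, n.X] := coequalizer.π_desc _ _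

lemma extUnit_desc : extUnit α m ≫ extDesc α f hf = f := by
  rw [extUnit, Category.assoc, Category.assoc, extπ_desc, ← action_exchange_assoc,
    ModObj.one_smul, Iso.inv_comp_eq]
  exact (actionUnitIso_hom_naturality f).symm

lemma extAct_desc : extAct α m ≫ extDesc α f hf = b.X ⊴ₗ extDesc α f hf ≫ γ[b.X, n.X] := by
  rw [← cancel_epi (b.X ⊴ₗ extπ α m), reassoc_of% (extπ_act α m), extπ_desc,
    ← actionHomRight_comp_assoc, extπ_desc, actionHomRight_comp_assoc, ModObj.assoc_flip,
    reassoc_of% (mul_naturality (b := b) f)]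

lemma extMapX_desc {m' : Mod M a.X} (g : m' ⟶ m) (h) :
    extMapX α g ≫ extDesc α f hf = extDesc α (g.hom ≫ f) h := by
  rw [← cancel_epi (extπ α m'), extπ_desc, reassoc_of% (extπ_map α g), extπ_desc,
    actionHomRight_comp_assoc]

end

section

variable {m : Mod M a.X} {n : Mod M b.X}

/-- The map underlying a morphism out of `b ⊠_a m`. -/
noncomputable def extHomX (g : extMod α m ⟶ n) : extX α m ⟶ n.X := g.hom

lemma extAct_homX (g : extMod α m ⟶ n) :
    extAct α m ≫ extHomX α g = b.X ⊴ₗ extHomX α g ≫ γ[b.X, n.X] :=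
  IsModHom.smul_hom (A := b.X) (f := g.hom)

lemma act_extUnit_homX (g : extMod α m ⟶ n) :
    γ[a.X, m.X] ≫ extUnit α m ≫ extHomX α g =
      a.X ⊴ₗ (extUnit α m ≫ extHomX α g) ≫ resAct α n := by
  rw [reassoc_of% (act_extUnit' α m), extAct_homX, resAct, action_exchange_assoc,
    action_exchange_assoc, actionHomRight_comp_assoc]

/-- Morphisms out of `b ⊠_a m` are `a`-linear morphisms out of `m`. -/
noncomputable def extHomEquiv : (extMod α m ⟶ n) ≃ (m ⟶ (restrict M α).obj n) where
  toFun g := Mod.Hom.mk' (extUnit α m ≫ extHomX α g) (act_extUnit_homX α g)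
  invFun f := Mod.Hom.mk' (extDesc α f.hom (restrict_hom α f)) (extAct_desc α _ _)
  left_inv g := by
    ext
    change extDesc α (extUnit α m ≫ extHomX α g) (act_extUnit_homX α g) = extHomX α g
    rw [← cancel_epi (extπ α m), extπ_desc, actionHomRight_comp_assoc, ← extAct_homX,
      reassoc_of% (whisker_extUnit_act α m)]
  right_inv f := by
    ext
    exact extUnit_desc α f.hom (restrict_hom α f)

end

variable (M) in
/-- Extension of scalars is left adjoint to restriction of scalars. -/
noncomputable def extRestrictAdjunction : extFunctor M α ⊣ restrict M α :=
  Adjunction.mkOfHomEquiv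
    { homEquiv m n := extHomEquiv α
      homEquiv_naturality_left_symm {m m' n} f g := by
        ext
        exact (extMapX_desc α (n := n) g.hom (restrict_hom α g) f (restrict_hom α (f ≫ g))).symm
      homEquiv_naturality_right f g := by
        ext
        exact (Category.assoc _ _ _).symm }

omit [HasColimits M] [CocontinuousAction C M] in
lemma resAct_comp {c : CommMon C} (β : b ⟶ c) (n : Mod M c.X) :
    resAct (α ≫ β) n = homX α ⊵ₗ n.X ≫ resAct β n := by
  rw [resAct, resAct, ← comp_actionHomLeft_assoc]
  rfl

omit [BraidedCategory C] [HasColimits M] [CocontinuousAction C M] in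
/-- A linear isomorphism of underlying objects is an isomorphism of modules. -/
def modIsoMk {a : C} [MonObj a] {n n' : Mod M a} (e : n.X ≅ n'.X)
    (h : γ[a, n.X] ≫ e.hom = a ⊴ₗ e.hom ≫ γ[a, n'.X]) : n ≅ n' :=
  haveI : IsModHom a e.hom := ⟨h⟩
  { hom := { hom := e.hom }
    inv := { hom := e.inv } }

variable {c : CommMon C} (β : b ⟶ c)

variable (M) in
/-- Restriction of scalars along a composition is the composition of the restrictions. -/
def restrictComp : restrict M β ⋙ restrict M α ≅ restrict M (α ≫ β) :=
  NatIso.ofComponents (fun n => modIsoMk (Iso.refl n.X) (by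
    change (homX α ⊵ₗ n.X ≫ resAct β n) ≫ 𝟙 n.X = a.X ⊴ₗ 𝟙 n.X ≫ resAct (α ≫ β) n
    rw [resAct_comp, Category.comp_id, actionHomRight_id, Category.id_comp])) (fun f => by
    ext
    exact (Category.comp_id _).trans (Category.id_comp _).symm)

variable (M a) in
/-- Restriction of scalars along the identity is the identity. -/
def restrictId : 𝟭 _ ≅ restrict M (𝟙 a) :=
  NatIso.ofComponents (fun n => modIsoMk (Iso.refl n.X) (by
    change γ[a.X, n.X] ≫ 𝟙 n.X = a.X ⊴ₗ 𝟙 n.X ≫ (𝟙 a.X) ⊵ₗ n.X ≫ γ[a.X, n.X]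
    rw [Category.comp_id, actionHomRight_id, Category.id_comp, id_actionHomLeft, Category.id_comp]))
    (fun f => by
      ext
      exact (Category.comp_id _).trans (Category.id_comp _).symm)

variable (M) in
/-- Extension of scalars along a composition is the composition of the extensions of scalars. -/
noncomputable def extFunctorComp : extFunctor M (α ≫ β) ≅ extFunctor M α ⋙ extFunctor M β :=
  (extRestrictAdjunction M (α ≫ β)).leftAdjointUniq
    (((extRestrictAdjunction M α).comp (extRestrictAdjunction M β)).ofNatIsoRight
      (restrictComp M α β))

variable (M) in
-- Restrictions of scalars compose, so by uniqueness of left adjoints extensions do, and left exact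
-- functors compose.
lemma IsFlat.comp {α : a ⟶ b} {β : b ⟶ c} (hα : IsFlat M α) (hβ : IsFlat M β) :
    IsFlat M (α ≫ β) := by
  have : PreservesFiniteLimits (extFunctor M α) := hα
  have : PreservesFiniteLimits (extFunctor M β) := hβ
  have : PreservesFiniteLimits (extFunctor M α ⋙ extFunctor M β) := comp_preservesFiniteLimits _ _
  exact preservesFiniteLimits_of_natIso (extFunctorComp M α β).symm

variable (M) in
lemma IsFlat.id (a : CommMon C) : IsFlat M (𝟙 a) :=
  preservesFiniteLimits_of_natIso
    ((Adjunction.id.ofNatIsoRight (restrictId M a)).leftAdjointUniq (extRestrictAdjunction M (𝟙 a)))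

end Adjunction

/-! ### Flatness and fpqc covers under `B` -/

section BaseChangeFlat

variable {C : Type u₁} [Category.{v} C] [MonoidalCategory C] [BraidedCategory C]
variable {D : Type u₂} [Category.{v} D] [MonoidalCategory D] [BraidedCategory D]
variable {M : Type u₃} [Category.{v} M] [MonoidalLeftAction C M] [HasFiniteLimits M]
variable {N : Type u₄} [Category.{v} N] [MonoidalLeftAction D N] [HasFiniteLimits N]
variable (B : C ⥤ D) [B.Braided] (L : N ⥤ M) [LaxLinearAlong B L]

instance [PreservesFiniteLimits L] (a : CommMon C) :
    PreservesFiniteLimits (LmodFunctor B L a) := by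
  rw [preservesFiniteLimits_iff_comp_forget]
  exact inferInstanceAs (PreservesFiniteLimits (Mod.forget (B.mapCommMon.obj a).X ⋙ L))

omit [HasFiniteLimits M] [HasFiniteLimits N] in
lemma isIso_of_isIso_LmodFunctor_map [L.ReflectsIsomorphisms] {a : CommMon C}
    {n n' : Mod N (B.mapCommMon.obj a).X} (φ : n ⟶ n') (h : IsIso ((LmodFunctor B L a).map φ)) :
    IsIso φ := by
  have h1 : IsIso ((Mod.forget a.X).map ((LmodFunctor B L a).map φ)) := inferInstance
  have h2 : IsIso (L.map ((Mod.forget (B.mapCommMon.obj a).X).map φ)) := h1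
  have h3 := isIso_of_reflects_iso ((Mod.forget (B.mapCommMon.obj a).X).map φ) L
  exact isIso_of_reflects_iso φ (Mod.forget (B.mapCommMon.obj a).X)

instance [L.ReflectsIsomorphisms] (a : CommMon C) : (LmodFunctor B L a).ReflectsIsomorphisms :=
  ⟨fun φ h => isIso_of_isIso_LmodFunctor_map B L φ h⟩

variable [HasColimits M] [HasColimits N] [CocontinuousAction C M] [CocontinuousAction D N]
variable {a b : CommMon C} (α : a ⟶ b)

omit [HasFiniteLimits M] [HasFiniteLimits N] in
lemma thetaX_naturality {n n' : Mod N (B.mapCommMon.obj a).X} (φ : n ⟶ n') :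
    extMapX α (LmodMap B L φ) ≫ thetaX B L α n' =
      thetaX B L α n ≫ L.map (extMapX (B.mapCommMon.map α) φ) := by
  have h : extπB B α n ≫ extMapX (B.mapCommMon.map α) φ = B.obj b.X ⊴ₗ φ.hom ≫ extπB B α n' :=
    extπ_map (B.mapCommMon.map α) φ
  have h' : b.X ⊴ₗ L.map φ.hom ≫ lin B L b.X n'.X ≫ L.map (extπB B α n') =
      (lin B L b.X n.X ≫ L.map (extπB B α n)) ≫ L.map (extMapX (B.mapCommMon.map α) φ) := by
    rw [Category.assoc, ← L.map_comp, h, L.map_comp, reassoc_of% (lin_naturality_right B L)]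
  rw [← cancel_epi (extπ α (Lmod B L n)), reassoc_of% (extπ_map α (LmodMap B L φ)), extπ_thetaX,
    reassoc_of% (extπ_thetaX B L α n)]
  exact h'

/-- The isomorphism of functors given by the canonical maps `theta`, if these are isomorphisms. -/
noncomputable def thetaIso (h : ∀ n, IsIso (theta B L α n)) :
    LmodFunctor B L a ⋙ extFunctor M α ≅ extFunctor N (B.mapCommMon.map α) ⋙ LmodFunctor B L b :=
  NatIso.ofComponents (fun n => @asIso _ _ _ _ (theta B L α n) (h n)) fun φ => by
    ext
    exact thetaX_naturality B L α φ

variable [L.ReflectsIsomorphisms]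

variable {α} in
/-- `B` takes flat morphisms to flat morphisms. -/
lemma isFlat_map [PreservesFiniteLimits L] (h : ∀ n, IsIso (theta B L α n)) (hα : IsFlat M α) :
    IsFlat N (B.mapCommMon.map α) := by
  have : PreservesFiniteLimits (extFunctor M α) := hα
  have h1 : PreservesFiniteLimits (LmodFunctor B L a ⋙ extFunctor M α) :=
    comp_preservesFiniteLimits _ _
  have h2 := preservesFiniteLimits_of_natIso (thetaIso B L α h)
  refine ⟨fun J _ _ => ?_⟩
  have := h2.preservesFiniteLimits J
  -- A conservative functor that preserves finite limits reflects them when its source has them, so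
  -- left exactness may be tested after applying `L`.
  have : ReflectsLimitsOfShape J (LmodFunctor B L b) := reflectsLimitsOfShape_of_reflectsIsomorphisms
  exact preservesLimitsOfShape_of_reflects_of_preserves _ (LmodFunctor B L b)

variable {α} in
omit [HasFiniteLimits M] [HasFiniteLimits N] [L.ReflectsIsomorphisms] in
-- The form in which `theta` transports joint conservativity: invertibility after extension in `N`
-- gives invertibility of `L(φ)` after extension in `M`.
lemma isIso_extFunctor_map_LmodFunctor (h : ∀ n, IsIso (theta B L α n))
    {n n' : Mod N (B.mapCommMon.obj a).X} (φ : n ⟶ n')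
    (hφ : IsIso ((extFunctor N (B.mapCommMon.map α)).map φ)) :
    IsIso ((extFunctor M α).map ((LmodFunctor B L a).map φ)) :=
  (NatIso.isIso_map_iff (thetaIso B L α h) φ).2
    (inferInstanceAs (IsIso ((LmodFunctor B L b).map ((extFunctor N (B.mapCommMon.map α)).map φ))))

/-- `B` takes fpqc covers to fpqc covers. -/
lemma IsFpqcCover.map [PreservesFiniteLimits L]
    (hθ : ∀ {a b : CommMon C} (α : a ⟶ b), IsFlat M α →
      ∀ n : Mod N (B.mapCommMon.obj a).X, IsIso (theta B L α n))
    {I : Type t} {X : Aff C} {Y : I → Aff C} {f : ∀ i, Y i ⟶ X} (hf : IsFpqcCover M Y f) :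
    IsFpqcCover N (fun i => (Bop B).obj (Y i)) (fun i => (Bop B).map (f i)) where
  flat i := isFlat_map B L (hθ _ (hf.flat i)) (hf.flat i)
  conservative := by
    obtain ⟨J, hJ⟩ := hf.conservative
    refine ⟨J, fun {n n'} φ hφ => ?_⟩
    exact isIso_of_isIso_LmodFunctor_map B L φ (hJ _ fun j hj =>
      isIso_extFunctor_map_LmodFunctor B L (hθ _ (hf.flat j)) φ (hφ j hj))

end BaseChangeFlat

/-! ### Sifted colimits of commutative monoids -/

section

variable {C : Type u₁} [Category.{v} C] [MonoidalCategory C] [BraidedCategory C]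

/-- A morphism of commutative monoids from a morphism of the underlying objects. -/
def commMonHom {a b : CommMon C} (f : a.X ⟶ b.X) (h₁ : η[a.X] ≫ f = η[b.X])
    (h₂ : μ[a.X] ≫ f = (f ⊗ₘ f) ≫ μ[b.X]) : a ⟶ b :=
  CommMon.homMk (Mon.Hom.mk (M := a.toMon) (N := b.toMon) f (isMonHom_hom := ⟨h₁, h₂⟩))

lemma homX_comp {a b c : CommMon C} (f : a ⟶ b) (g : b ⟶ c) : homX (f ≫ g) = homX f ≫ homX g :=
  rfl

lemma homX_id (a : CommMon C) : homX (𝟙 a) = 𝟙 a.X := rfl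

lemma commMon_hom_ext {a b : CommMon C} {f g : a ⟶ b} (h : homX f = homX g) : f = g :=
  CommMon.hom_ext _ _ h

end

section SiftedColimits

variable {C : Type u₁} [Category.{v} C] [MonoidalCategory C] [SymmetricCategory C]
variable {J : Type w} [Category.{t} J]

instance : (CommMon.forget C).ReflectsIsomorphisms :=
  inferInstanceAs ((CommMon.forget₂Mon C ⋙ Mon.forget C).ReflectsIsomorphisms)

variable {F : J ⥤ CommMon C} (c : Cocone (F ⋙ CommMon.forget C))

/-- A leg of a cocone under the underlying objects of a diagram of commutative monoids. -/
def monLeg (j : J) : (F.obj j).X ⟶ c.pt := c.ι.app j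

lemma monLeg_w {i j : J} (f : i ⟶ j) : homX (F.map f) ≫ monLeg c j = monLeg c i := c.w f

variable {c}

lemma monLeg_hom_ext (hc : IsColimit c) {x : C} {f g : c.pt ⟶ x}
    (h : ∀ j, monLeg c j ≫ f = monLeg c j ≫ g) : f = g := hc.hom_ext h

section

variable [MonoidalClosed C] [IsSifted J]

/-- The closed structure makes the tensor product cocontinuous in each variable, and siftedness
reduces the resulting double colimit to its diagonal. Hence `c.pt ⊗ c.pt` is the colimit of the
objects `F j ⊗ F j`. -/
lemma monLeg_tensor_hom_ext (hc : IsColimit c) {x : C} {f g : c.pt ⊗ c.pt ⟶ x}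
    (h : ∀ j, (monLeg c j ⊗ₘ monLeg c j) ≫ f = (monLeg c j ⊗ₘ monLeg c j) ≫ g) : f = g :=
  (hc.tensor hc).hom_ext h

lemma monLeg_tensor_tensor_hom_ext (hc : IsColimit c) {x : C} {f g : (c.pt ⊗ c.pt) ⊗ c.pt ⟶ x}
    (h : ∀ j, ((monLeg c j ⊗ₘ monLeg c j) ⊗ₘ monLeg c j) ≫ f =
      ((monLeg c j ⊗ₘ monLeg c j) ⊗ₘ monLeg c j) ≫ g) : f = g :=
  ((hc.tensor hc).tensor hc).hom_ext h

variable (hc : IsColimit c)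

/-- The cocone defining the multiplication on a sifted colimit of commutative monoids. -/
def mulCocone (c : Cocone (F ⋙ CommMon.forget C)) :
    Cocone ((F ⋙ CommMon.forget C) ⊗ (F ⋙ CommMon.forget C)) :=
  Cocone.mk c.pt
    { app j := μ[(F.obj j).X] ≫ monLeg c j
      naturality i j f := by
        change (homX (F.map f) ⊗ₘ homX (F.map f)) ≫ μ[(F.obj j).X] ≫ monLeg c j =
          (μ[(F.obj i).X] ≫ monLeg c i) ≫ 𝟙 _
        rw [Category.comp_id, ← monLeg_w c f, IsMonHom.mul_hom_assoc] }

/-- The multiplication on a sifted colimit of commutative monoids. -/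
noncomputable def colimitMul : c.pt ⊗ c.pt ⟶ c.pt := (hc.tensor hc).desc (mulCocone c)

lemma monLeg_mul (j : J) :
    (monLeg c j ⊗ₘ monLeg c j) ≫ colimitMul hc = μ[(F.obj j).X] ≫ monLeg c j :=
  (hc.tensor hc).fac (mulCocone c) j

end

variable [IsSifted J]

/-- The unit of a sifted colimit of commutative monoids. -/
noncomputable def colimitOne (c : Cocone (F ⋙ CommMon.forget C)) : 𝟙_ C ⟶ c.pt :=
  η[(F.obj (IsSifted.nonempty (C := J)).some).X] ≫ monLeg c _

/-- Transition maps preserve units and a sifted category is connected, so the unit does not depend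
on the stage. -/
lemma one_monLeg (c : Cocone (F ⋙ CommMon.forget C)) (j : J) :
    η[(F.obj j).X] ≫ monLeg c j = colimitOne c :=
  constant_of_preserves_morphisms (fun j => η[(F.obj j).X] ≫ monLeg c j) (fun i j f => by
    rw [← monLeg_w c f, IsMonHom.one_hom_assoc]) _ _

variable [MonoidalClosed C]

variable (hc : IsColimit c)

/-- The monoid structure on a sifted colimit of commutative monoids. -/
@[reducible]
noncomputable def colimitMonObj : MonObj c.pt where
  one := colimitOne c
  mul := colimitMul hc
  one_mul := by
    -- Composing with the inverse unitor turns the source into `c.pt`, where equality is tested on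
    -- the legs.
    rw [← cancel_epi (λ_ c.pt).inv, Iso.inv_hom_id]
    refine monLeg_hom_ext hc fun j => ?_
    rw [leftUnitor_inv_naturality_assoc, ← one_monLeg c j, comp_whiskerRight_assoc,
      whisker_exchange_assoc, ← tensorHom_def'_assoc, monLeg_mul, MonObj.one_mul_assoc,
      Iso.inv_hom_id_assoc, Category.comp_id]
  mul_one := by
    rw [← cancel_epi (ρ_ c.pt).inv, Iso.inv_hom_id]
    refine monLeg_hom_ext hc fun j => ?_
    rw [rightUnitor_inv_naturality_assoc, ← one_monLeg c j, MonoidalCategory.whiskerLeft_comp_assoc,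
      ← whisker_exchange_assoc, ← tensorHom_def_assoc, monLeg_mul, MonObj.mul_one_assoc,
      Iso.inv_hom_id_assoc, Category.comp_id]
  mul_assoc := by
    refine monLeg_tensor_tensor_hom_ext hc fun j => ?_
    have e₁ : (μ[(F.obj j).X] ≫ monLeg c j ⊗ₘ monLeg c j) =
        μ[(F.obj j).X] ▷ (F.obj j).X ≫ (monLeg c j ⊗ₘ monLeg c j) := by
      simp [MonoidalCategory.tensorHom_def]
    have e₂ : (monLeg c j ⊗ₘ μ[(F.obj j).X] ≫ monLeg c j) =
        (F.obj j).X ◁ μ[(F.obj j).X] ≫ (monLeg c j ⊗ₘ monLeg c j) := by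
      simp [MonoidalCategory.tensorHom_def']
    rw [← tensorHom_id, tensorHom_comp_tensorHom_assoc, Category.comp_id, monLeg_mul,
      associator_naturality_assoc, ← id_tensorHom, tensorHom_comp_tensorHom_assoc,
      Category.comp_id, monLeg_mul, e₁, e₂, Category.assoc, Category.assoc, monLeg_mul,
      MonObj.mul_assoc_assoc]

/-- The sifted colimit of commutative monoids, built on the colimit of the underlying objects. -/
noncomputable def colimitCommMon : CommMon C :=
  letI := colimitMonObj hc
  { X := c.pt
    comm := ⟨by
      refine monLeg_tensor_hom_ext hc fun j => ?_
      change _ ≫ _ ≫ colimitMul hc = _ ≫ colimitMul hc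
      rw [BraidedCategory.braiding_naturality_assoc, monLeg_mul, IsCommMonObj.mul_comm_assoc]⟩ }

/-- The colimit cocone on a sifted diagram of commutative monoids. -/
noncomputable def colimitCommMonCocone : Cocone F :=
  Cocone.mk (colimitCommMon hc)
    { app j := commMonHom (monLeg c j) (one_monLeg c j) (monLeg_mul hc j).symm
      naturality i j f := by
        apply commMon_hom_ext
        change homX (F.map f) ≫ monLeg c j = monLeg c i ≫ 𝟙 _
        rw [monLeg_w, Category.comp_id] }

/-- The map underlying the universal morphism out of `colimitCommMon`. -/
noncomputable def colimitCommMonDescX (s : Cocone F) : c.pt ⟶ s.pt.X :=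
  hc.desc ((CommMon.forget C).mapCocone s)

lemma monLeg_descX (s : Cocone F) (j : J) :
    monLeg c j ≫ colimitCommMonDescX hc s = homX (s.ι.app j) :=
  hc.fac ((CommMon.forget C).mapCocone s) j

/-- `colimitCommMonCocone` is a colimit cocone. -/
noncomputable def colimitCommMonCoconeIsColimit : IsColimit (colimitCommMonCocone hc) where
  desc s := commMonHom (a := colimitCommMon hc) (colimitCommMonDescX hc s)
    (by
      change colimitOne c ≫ colimitCommMonDescX hc s = _
      rw [← one_monLeg c (IsSifted.nonempty (C := J)).some, Category.assoc, monLeg_descX,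
        IsMonHom.one_hom])
    (by
      refine monLeg_tensor_hom_ext hc fun j => ?_
      change _ ≫ colimitMul hc ≫ colimitCommMonDescX hc s =
        (monLeg c j ⊗ₘ monLeg c j) ≫ (colimitCommMonDescX hc s ⊗ₘ colimitCommMonDescX hc s) ≫ _
      rw [reassoc_of% monLeg_mul, monLeg_descX, tensorHom_comp_tensorHom_assoc, monLeg_descX,
        IsMonHom.mul_hom])
  fac s j := commMon_hom_ext (monLeg_descX hc s j)
  uniq s m h := by
    apply commMon_hom_ext
    exact hc.uniq ((CommMon.forget C).mapCocone s) (homX m)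
      fun j => congrArg (CommMon.forget C).map (h j)

/-- The forgetful functor from commutative monoids creates sifted colimits. -/
noncomputable instance : CreatesColimitsOfShape J (CommMon.forget C) where
  CreatesColimit := createsColimitOfReflectsIso fun _ hc =>
    { liftedCocone := colimitCommMonCocone hc
      validLift := Cocone.ext (Iso.refl _) fun _ => Category.comp_id _
      makesColimit := colimitCommMonCoconeIsColimit hc }

end SiftedColimits

section

variable {C : Type u₁} [Category.{v} C] [MonoidalCategory C] [SymmetricCategory C]
  [MonoidalClosed C]
variable {D : Type u₂} [Category.{v} D] [MonoidalCategory D] [SymmetricCategory D]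
  [MonoidalClosed D] [HasColimits D]

/-- Filtered categories are sifted, so both forgetful functors preserve these colimits and reflect
them; the functor on monoids lies over `A`. -/
lemma preservesFilteredColimits_mapCommMon (A : D ⥤ C) [A.LaxBraided]
    [PreservesFilteredColimits A] : PreservesFilteredColimits A.mapCommMon := by
  refine ⟨fun J _ _ => ?_⟩
  have : IsSifted J := IsFiltered.isSifted
  have : PreservesColimitsOfShape J (A.mapCommMon ⋙ CommMon.forget C) :=
    inferInstanceAs (PreservesColimitsOfShape J (CommMon.forget D ⋙ A))
  exact preservesColimitsOfShape_of_reflects_of_preserves A.mapCommMon (CommMon.forget C)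

end

/-! ### Reflexive pairs are sifted -/

section

open WalkingReflexivePair

/-- The category indexing reflexive pairs is sifted. -/
instance isSifted_walkingReflexivePair : IsSifted WalkingReflexivePair where
  nonempty := ⟨.zero⟩
  out := by
    let ob {x y z : WalkingReflexivePair} (u : x ⟶ z) (v : y ⟶ z) :
        StructuredArrow (x, y) (Functor.diag WalkingReflexivePair) :=
      StructuredArrow.mk (Y := z) (Prod.mkHom u v)
    have H {x y z z' : WalkingReflexivePair} {u : x ⟶ z} {v : y ⟶ z} (f : z ⟶ z')
        {p : Set (StructuredArrow (x, y) (Functor.diag WalkingReflexivePair))}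
        (h : ∀ {j₁ j₂}, (j₁ ⟶ j₂) → (j₁ ∈ p ↔ j₂ ∈ p)) :
        ob u v ∈ p ↔ ob (u ≫ f) (v ≫ f) ∈ p :=
      h (StructuredArrow.homMk f rfl)
    have key (x y : WalkingReflexivePair)
        (j₀ : StructuredArrow (x, y) (Functor.diag WalkingReflexivePair))
        (h : ∀ p : Set (StructuredArrow (x, y) (Functor.diag WalkingReflexivePair)), j₀ ∈ p →
          (∀ {j₁ j₂}, (j₁ ⟶ j₂) → (j₁ ∈ p ↔ j₂ ∈ p)) →
          ∀ (u : x ⟶ .zero) (v : y ⟶ .zero), ob u v ∈ p) :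
        IsConnected (StructuredArrow (x, y) (Functor.diag WalkingReflexivePair)) := by
      refine IsConnected.of_induct (j₀ := j₀) fun p h₁ h₂ => ?_
      -- The objects are cospans out of `x` and `y`. One with apex `one` maps by `Hom.left` to one
      -- with apex `zero`, so only apex `zero` has to be treated case by case.
      rintro ⟨⟨⟨⟩⟩, (_ | _), ⟨u, v⟩⟩
      · exact h p h₁ h₂ u v
      · exact (H Hom.left h₂).2 (h p h₁ h₂ _ _)
    rintro ⟨(_ | _), (_ | _)⟩
    · refine key _ _ (ob (𝟙 WalkingReflexivePair.zero) (𝟙 WalkingReflexivePair.zero)) fun p h₁ h₂ => ?_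
      rintro (_ | _) (_ | _)
      exact h₁
    · refine key _ _ (ob Hom.reflexion (𝟙 WalkingReflexivePair.one)) fun p h₁ h₂ => ?_
      rintro (_ | _) (_ | _)
      · exact (H Hom.left h₂).1 h₁
      · exact (H Hom.right h₂).1 h₁
    · refine key _ _ (ob (𝟙 WalkingReflexivePair.one) Hom.reflexion) fun p h₁ h₂ => ?_
      rintro (_ | _) (_ | _)
      · exact (H Hom.left h₂).1 h₁
      · exact (H Hom.right h₂).1 h₁
    · refine key _ _ (ob (𝟙 WalkingReflexivePair.one) (𝟙 WalkingReflexivePair.one)) fun p h₁ h₂ => ?_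
      have h₃ : ob Hom.left Hom.left ∈ p := (H Hom.left h₂).1 h₁
      rintro (_ | _) (_ | _)
      · exact h₃
      -- The mixed pair `(left, right)` is linked to `(left, left)` by the cospan `(left ≫
      -- reflexion, 𝟙)` with apex `one`: `left` sends it to the latter, `right` to the former. The
      -- next case is symmetric.
      · exact (H (u := Hom.leftCompReflexion) (v := 𝟙 WalkingReflexivePair.one) Hom.right h₂).1 ((H Hom.left h₂).2 h₃)
      · exact (H (u := 𝟙 WalkingReflexivePair.one) (v := Hom.leftCompReflexion) Hom.right h₂).1 ((H Hom.left h₂).2 h₃)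
      · exact (H Hom.right h₂).1 h₁

end

/-! ### Tensor products as coproducts of commutative monoids -/

section Coproduct

variable {C : Type u₁} [Category.{v} C] [MonoidalCategory C] [SymmetricCategory C]

/-- The tensor product of commutative monoids. -/
def tensorCommMon (a b : CommMon C) : CommMon C where
  X := a.X ⊗ b.X

variable {a b c : CommMon C}

/-- The tensor product of morphisms of commutative monoids. -/
def tensorMap {a' b' : CommMon C} (f : a ⟶ a') (g : b ⟶ b') :
    tensorCommMon a b ⟶ tensorCommMon a' b' :=
  commMonHom (a := tensorCommMon a b) (b := tensorCommMon a' b') (homX f ⊗ₘ homX g)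
    (IsMonHom.one_hom (f := homX f ⊗ₘ homX g)) (IsMonHom.mul_hom (f := homX f ⊗ₘ homX g))

variable (a) in
/-- The multiplication of a commutative monoid, as a morphism of commutative monoids. -/
def mulHom : tensorCommMon a a ⟶ a :=
  commMonHom (a := tensorCommMon a a) (b := a) μ[a.X]
    (by
      change ((λ_ _).inv ≫ (η[a.X] ⊗ₘ η[a.X])) ≫ μ[a.X] = η[a.X]
      rw [Category.assoc, MonoidalCategory.tensorHom_def, Category.assoc, MonObj.mul_one]
      simp [← unitors_equal])
    (by
      -- Commutativity is what makes the multiplication a morphism of monoids.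
      change (tensorμ _ _ _ _ ≫ (μ[a.X] ⊗ₘ μ[a.X])) ≫ μ[a.X] = (μ[a.X] ⊗ₘ μ[a.X]) ≫ μ[a.X]
      rw [Category.assoc, MonObj.mul_mul_mul_comm])

instance (a : C) [MonObj a] : IsMonHom (η[a]) where
  mul_hom := by simp [← unitors_equal]

variable (a b) in
/-- The first inclusion into the tensor product of commutative monoids. -/
def inlHom : a ⟶ tensorCommMon a b :=
  have : IsMonHom ((ρ_ a.X).inv ≫ (𝟙 a.X ⊗ₘ η[b.X])) := inferInstance
  commMonHom (a := a) (b := tensorCommMon a b) ((ρ_ a.X).inv ≫ (𝟙 a.X ⊗ₘ η[b.X]))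
    this.one_hom this.mul_hom

variable (a b) in
/-- The second inclusion into the tensor product of commutative monoids. -/
def inrHom : b ⟶ tensorCommMon a b :=
  have : IsMonHom ((λ_ b.X).inv ≫ (η[a.X] ⊗ₘ 𝟙 b.X)) := inferInstance
  commMonHom (a := b) (b := tensorCommMon a b) ((λ_ b.X).inv ≫ (η[a.X] ⊗ₘ 𝟙 b.X))
    this.one_hom this.mul_hom

/-- The morphism out of a tensor product of commutative monoids. -/
def coprodDesc (f : a ⟶ c) (g : b ⟶ c) : tensorCommMon a b ⟶ c := tensorMap f g ≫ mulHom c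

lemma homX_coprodDesc (f : a ⟶ c) (g : b ⟶ c) :
    homX (coprodDesc f g) = (homX f ⊗ₘ homX g) ≫ μ[c.X] := rfl

lemma inl_desc (f : a ⟶ c) (g : b ⟶ c) : inlHom a b ≫ coprodDesc f g = f := by
  apply commMon_hom_ext
  change ((ρ_ a.X).inv ≫ (𝟙 a.X ⊗ₘ η[b.X])) ≫ (homX f ⊗ₘ homX g) ≫ μ[c.X] = homX f
  rw [Category.assoc, tensorHom_comp_tensorHom_assoc, Category.id_comp, IsMonHom.one_hom,
    MonoidalCategory.tensorHom_def, Category.assoc, MonObj.mul_one,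
    rightUnitor_naturality, Iso.inv_hom_id_assoc]

lemma inr_desc (f : a ⟶ c) (g : b ⟶ c) : inrHom a b ≫ coprodDesc f g = g := by
  apply commMon_hom_ext
  change ((λ_ b.X).inv ≫ (η[a.X] ⊗ₘ 𝟙 b.X)) ≫ (homX f ⊗ₘ homX g) ≫ μ[c.X] = homX g
  rw [Category.assoc, tensorHom_comp_tensorHom_assoc, Category.id_comp, IsMonHom.one_hom,
    MonoidalCategory.tensorHom_def', Category.assoc, MonObj.one_mul,
    leftUnitor_naturality, Iso.inv_hom_id_assoc]

/-- This identity, together with `coprodDesc_comp`, gives the uniqueness half of the universal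
property of the coproduct. -/
lemma coprodDesc_inl_inr : coprodDesc (inlHom a b) (inrHom a b) = 𝟙 (tensorCommMon a b) := by
  apply commMon_hom_ext
  change (((ρ_ a.X).inv ≫ (𝟙 a.X ⊗ₘ η[b.X])) ⊗ₘ ((λ_ b.X).inv ≫ (η[a.X] ⊗ₘ 𝟙 b.X))) ≫
    tensorμ a.X b.X a.X b.X ≫ (μ[a.X] ⊗ₘ μ[b.X]) = 𝟙 (a.X ⊗ b.X)
  rw [← tensorHom_comp_tensorHom, Category.assoc, tensorμ_natural_assoc,
    tensorHom_comp_tensorHom, id_tensorHom, tensorHom_id, MonObj.mul_one, MonObj.one_mul]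
  -- By now `tensorμ` only swaps two copies of the unit object, and that swap is the identity; the
  -- rest is coherence.
  have h : (β_ (𝟙_ C) (𝟙_ C)).hom = 𝟙 _ := by
    rw [braiding_tensorUnit_left, unitors_equal, Iso.hom_inv_id]
  rw [tensorμ, h]
  monoidal

lemma coprodDesc_comp {d : CommMon C} (f : a ⟶ c) (g : b ⟶ c) (h : c ⟶ d) :
    coprodDesc f g ≫ h = coprodDesc (f ≫ h) (g ≫ h) := by
  apply commMon_hom_ext
  change ((homX f ⊗ₘ homX g) ≫ μ[c.X]) ≫ homX h = ((homX f ≫ homX h) ⊗ₘ (homX g ≫ homX h)) ≫ μ[d.X]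
  rw [Category.assoc, IsMonHom.mul_hom, MonoidalCategory.tensorHom_comp_tensorHom_assoc]

lemma coprod_hom_ext {f g : tensorCommMon a b ⟶ c} (h₁ : inlHom a b ≫ f = inlHom a b ≫ g)
    (h₂ : inrHom a b ≫ f = inrHom a b ≫ g) : f = g := by
  rw [← Category.id_comp f, ← Category.id_comp g, ← coprodDesc_inl_inr, coprodDesc_comp,
    coprodDesc_comp, h₁, h₂]

lemma inl_tensorMap {a' b' : CommMon C} (f : a ⟶ a') (g : b ⟶ b') :
    inlHom a b ≫ tensorMap f g = f ≫ inlHom a' b' := by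
  apply commMon_hom_ext
  change ((ρ_ a.X).inv ≫ (𝟙 a.X ⊗ₘ η[b.X])) ≫ (homX f ⊗ₘ homX g) =
    homX f ≫ (ρ_ a'.X).inv ≫ (𝟙 a'.X ⊗ₘ η[b'.X])
  rw [Category.assoc, tensorHom_comp_tensorHom, Category.id_comp, IsMonHom.one_hom,
    rightUnitor_inv_naturality_assoc, ← tensorHom_id, tensorHom_comp_tensorHom,
    Category.comp_id, Category.id_comp]

lemma inr_tensorMap {a' b' : CommMon C} (f : a ⟶ a') (g : b ⟶ b') :
    inrHom a b ≫ tensorMap f g = g ≫ inrHom a' b' := by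
  apply commMon_hom_ext
  change ((λ_ b.X).inv ≫ (η[a.X] ⊗ₘ 𝟙 b.X)) ≫ (homX f ⊗ₘ homX g) =
    homX g ≫ (λ_ b'.X).inv ≫ (η[a'.X] ⊗ₘ 𝟙 b'.X)
  rw [Category.assoc, tensorHom_comp_tensorHom, Category.id_comp, IsMonHom.one_hom,
    leftUnitor_inv_naturality_assoc, ← id_tensorHom, tensorHom_comp_tensorHom,
    Category.comp_id, Category.id_comp]

lemma coprodDesc_comp_inl_inr {a' b' : CommMon C} (f : a ⟶ a') (g : b ⟶ b') :
    coprodDesc (f ≫ inlHom a' b') (g ≫ inrHom a' b') = tensorMap f g := by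
  apply coprod_hom_ext
  · rw [inl_desc, inl_tensorMap]
  · rw [inr_desc, inr_tensorMap]

lemma homX_coprodDesc_assoc {d : CommMon C} (f : a ⟶ d) (g : b ⟶ d) (h : c ⟶ d) :
    homX (coprodDesc (coprodDesc f g) h) =
      (α_ a.X b.X c.X).hom ≫ homX (coprodDesc f (coprodDesc g h)) := by
  change ((homX f ⊗ₘ homX g) ≫ μ[d.X] ⊗ₘ homX h) ≫ μ[d.X] =
    (α_ a.X b.X c.X).hom ≫ (homX f ⊗ₘ (homX g ⊗ₘ homX h) ≫ μ[d.X]) ≫ μ[d.X]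
  have e₁ : ((homX f ⊗ₘ homX g) ≫ μ[d.X] ⊗ₘ homX h) =
      ((homX f ⊗ₘ homX g) ⊗ₘ homX h) ≫ μ[d.X] ▷ d.X := by
    rw [← tensorHom_id, tensorHom_comp_tensorHom, Category.comp_id]
  have e₂ : (homX f ⊗ₘ (homX g ⊗ₘ homX h) ≫ μ[d.X]) =
      (homX f ⊗ₘ (homX g ⊗ₘ homX h)) ≫ d.X ◁ μ[d.X] := by
    rw [← id_tensorHom, tensorHom_comp_tensorHom, Category.comp_id]
  rw [e₁, e₂, Category.assoc, Category.assoc, MonObj.mul_assoc, associator_naturality_assoc]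

end Coproduct

/-! ### Pushouts of commutative monoids as reflexive coequalizers -/

section Pushout

variable {C : Type u₁} [Category.{v} C] [MonoidalCategory C] [SymmetricCategory C]
variable {a b c : CommMon C} (α : a ⟶ b) (β : a ⟶ c)

variable (c) in
/-- The map `(b ⊗ a) ⊗ c ⟶ b ⊗ c` given by the action of `a` on `b`. -/
def poFst : tensorCommMon (tensorCommMon b a) c ⟶ tensorCommMon b c :=
  coprodDesc (coprodDesc (inlHom b c) (α ≫ inlHom b c)) (inrHom b c)

variable (b) in
/-- The map `(b ⊗ a) ⊗ c ⟶ b ⊗ c` given by the action of `a` on `c`. -/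
def poSnd : tensorCommMon (tensorCommMon b a) c ⟶ tensorCommMon b c :=
  coprodDesc (coprodDesc (inlHom b c) (β ≫ inrHom b c)) (inrHom b c)

/-- The universal property of the coproduct makes `poFst` a morphism of monoids for free;
computations with modules need its underlying map. -/
lemma homX_poFst : homX (poFst c α) = (b.X ◁ homX α ≫ μ[b.X]) ▷ c.X := by
  have h : poFst c α = tensorMap (coprodDesc (𝟙 b) α) (𝟙 c) := by
    rw [← coprodDesc_comp_inl_inr, coprodDesc_comp, Category.id_comp, Category.id_comp]
    rfl
  rw [h]
  change ((𝟙 b.X ⊗ₘ homX α) ≫ μ[b.X]) ⊗ₘ 𝟙 c.X = _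
  rw [tensorHom_id, id_tensorHom]

lemma homX_poSnd : homX (poSnd b β) = (α_ b.X a.X c.X).hom ≫ b.X ◁ (homX β ▷ c.X ≫ μ[c.X]) := by
  have h : coprodDesc (inlHom b c) (coprodDesc (β ≫ inrHom b c) (inrHom b c)) =
      tensorMap (𝟙 b) (coprodDesc β (𝟙 c)) := by
    rw [← coprodDesc_comp_inl_inr, coprodDesc_comp, Category.id_comp, Category.id_comp]
  rw [poSnd, homX_coprodDesc_assoc, h]
  change _ ≫ (𝟙 b.X ⊗ₘ (homX β ⊗ₘ 𝟙 c.X) ≫ μ[c.X]) = _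
  rw [tensorHom_id, id_tensorHom]

/-- Inserting the unit of `a` between `b` and `c` is a common section. Reflexivity is what makes the
coequalizer a sifted colimit, hence computed in `C`. -/
instance : IsReflexivePair (poFst c α) (poSnd b β) :=
  IsReflexivePair.mk' (tensorMap (inlHom b a) (𝟙 c))
    (by
      apply coprod_hom_ext
      · rw [← Category.assoc, inl_tensorMap, Category.assoc, poFst, inl_desc, inl_desc,
          Category.comp_id]
      · rw [← Category.assoc, inr_tensorMap, Category.assoc, poFst, inr_desc, Category.comp_id,
          Category.id_comp])
    (by
      apply coprod_hom_ext
      · rw [← Category.assoc, inl_tensorMap, Category.assoc, poSnd, inl_desc, inl_desc,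
          Category.comp_id]
      · rw [← Category.assoc, inr_tensorMap, Category.assoc, poSnd, inr_desc, Category.comp_id,
          Category.id_comp])

variable [MonoidalClosed C] [HasColimits C]

instance : HasCoequalizer (poFst c α) (poSnd b β) := by
  have : HasColimitsOfShape WalkingReflexivePair (CommMon C) :=
    hasColimitsOfShape_of_hasColimitsOfShape_createsColimitsOfShape (CommMon.forget C)
  have : HasReflexiveCoequalizers (CommMon C) :=
    hasReflexiveCoequalizers_iff.mp inferInstance
  infer_instance

instance : PreservesColimit (parallelPair (poFst c α) (poSnd b β)) (CommMon.forget C) := by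
  have : PreservesColimit (WalkingParallelPair.inclusionWalkingReflexivePair ⋙
      ofIsReflexivePair (poFst c α) (poSnd b β)) (CommMon.forget C) := inferInstance
  exact preservesColimit_of_iso_diagram _ (inclusionWalkingReflexivePairOfIsReflexivePairIso _ _)

/-- The pushout of commutative monoids, as a coequalizer of maps between tensor products. -/
noncomputable def tensorOver : CommMon C := coequalizer (poFst c α) (poSnd b β)

/-- The projection onto the pushout of commutative monoids. -/
noncomputable def tensorOverπ : tensorCommMon b c ⟶ tensorOver α β := coequalizer.π _ _

lemma tensorOver_condition : poFst c α ≫ tensorOverπ α β = poSnd b β ≫ tensorOverπ α β :=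
  coequalizer.condition _ _

lemma tensorOver_hom_ext {d : CommMon C} {f g : tensorOver α β ⟶ d}
    (h : tensorOverπ α β ≫ f = tensorOverπ α β ≫ g) : f = g := coequalizer.hom_ext h

omit [MonoidalClosed C] [HasColimits C] in
variable {α β} in
lemma poFst_coprodDesc {d : CommMon C} (f : b ⟶ d) (g : c ⟶ d) (h : α ≫ f = β ≫ g) :
    poFst c α ≫ coprodDesc f g = poSnd b β ≫ coprodDesc f g := by
  simp only [poFst, poSnd, coprodDesc_comp, Category.assoc, inl_desc, inr_desc, h]

/-- The morphism out of the pushout of commutative monoids. -/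
noncomputable def tensorOverDesc {d : CommMon C} (f : b ⟶ d) (g : c ⟶ d) (h : α ≫ f = β ≫ g) :
    tensorOver α β ⟶ d :=
  coequalizer.desc (coprodDesc f g) (poFst_coprodDesc f g h)

lemma tensorOverπ_desc {d : CommMon C} (f : b ⟶ d) (g : c ⟶ d) (h : α ≫ f = β ≫ g) :
    tensorOverπ α β ≫ tensorOverDesc α β f g h = coprodDesc f g := coequalizer.π_desc _ _

/-- The first inclusion into the pushout of commutative monoids. -/
noncomputable def tensorOverInl : b ⟶ tensorOver α β := inlHom b c ≫ tensorOverπ α β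

/-- The second inclusion into the pushout of commutative monoids. -/
noncomputable def tensorOverInr : c ⟶ tensorOver α β := inrHom b c ≫ tensorOverπ α β

/-- Restrict the coequalizer relation to the middle factor `a` of `(b ⊗ a) ⊗ c`. -/
lemma tensorOver_w : α ≫ tensorOverInl α β = β ≫ tensorOverInr α β := by
  have h := congrArg (fun f => inrHom b a ≫ inlHom _ c ≫ f) (tensorOver_condition α β)
  rw [poFst, poSnd, reassoc_of% inl_desc, reassoc_of% inl_desc, reassoc_of% inr_desc, reassoc_of% inr_desc] at h
  rw [tensorOverInl, tensorOverInr]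
  simpa using h

lemma tensorOver_isPushout : IsPushout α β (tensorOverInl α β) (tensorOverInr α β) where
  w := tensorOver_w α β
  isColimit' := ⟨PushoutCocone.IsColimit.mk _
    (fun s => tensorOverDesc α β s.inl s.inr s.condition)
    (fun s => by rw [tensorOverInl, Category.assoc, tensorOverπ_desc, inl_desc])
    (fun s => by rw [tensorOverInr, Category.assoc, tensorOverπ_desc, inr_desc])
    (fun s m h₁ h₂ => by
      apply tensorOver_hom_ext
      rw [tensorOverπ_desc]
      apply coprod_hom_ext
      · rw [inl_desc, ← h₁, tensorOverInl, Category.assoc]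
      · rw [inr_desc, ← h₂, tensorOverInr, Category.assoc])⟩

lemma tensorOverπ_eq :
    tensorOverπ α β = coprodDesc (tensorOverInl α β) (tensorOverInr α β) := by
  rw [tensorOverInl, tensorOverInr, ← coprodDesc_comp, coprodDesc_inl_inr, Category.id_comp]

end Pushout
-- Base change of flat morphisms
section FlatBaseChange

variable {C : Type u₁} [Category.{v} C] [MonoidalCategory C] [SymmetricCategory C]
variable {M : Type u₃} [Category.{v} M] [MonoidalLeftAction C M]

omit [SymmetricCategory C] in
lemma assocIso_inv_whiskerRight {x y : C} (f : x ⟶ y) (z : C) (m : M) :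
    (αₗ x z m).inv ≫ (f ▷ z) ⊵ₗ m = f ⊵ₗ (z ⊙ₗ m) ≫ (αₗ y z m).inv := by
  rw [whiskerRight_actionHomLeft, Iso.inv_hom_id_assoc]

omit [SymmetricCategory C] in
lemma assocIso_inv_whiskerLeft (z : C) {x y : C} (f : x ⟶ y) (m : M) :
    (αₗ z x m).inv ≫ (z ◁ f) ⊵ₗ m = z ⊴ₗ f ⊵ₗ m ≫ (αₗ z y m).inv := by
  rw [whiskerLeft_actionHomLeft, Iso.inv_hom_id_assoc]

omit [SymmetricCategory C] in
lemma whiskerRight_assocIso_hom {x y : C} (f : x ⟶ y) (z : C) (m : M) :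
    (f ▷ z) ⊵ₗ m ≫ (αₗ y z m).hom = (αₗ x z m).hom ≫ f ⊵ₗ (z ⊙ₗ m) := by
  rw [whiskerRight_actionHomLeft, Category.assoc, Category.assoc, Iso.inv_hom_id, Category.comp_id]

omit [SymmetricCategory C] in
lemma whiskerLeft_assocIso_hom (z : C) {x y : C} (f : x ⟶ y) (m : M) :
    (z ◁ f) ⊵ₗ m ≫ (αₗ z y m).hom = (αₗ z x m).hom ≫ z ⊴ₗ f ⊵ₗ m := by
  rw [whiskerLeft_actionHomLeft, Category.assoc, Category.assoc, Iso.inv_hom_id, Category.comp_id]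

variable [HasColimits M]
variable {a b c : CommMon C} (α : a ⟶ b) (β : a ⟶ c)

section

variable (m : Mod M c.X)

/-- The projection `b ⊠ m ⟶ b ⊠_a m` for a `c`-module `m` restricted along `a ⟶ c`. -/
noncomputable def resπ : b.X ⊙ₗ m.X ⟶ extX α ((restrict M β).obj m) :=
  extπ α ((restrict M β).obj m)

lemma resπ_condition : b.X ⊴ₗ resAct β m ≫ resπ α β m =
    (αₗ b.X a.X m.X).inv ≫ (b.X ◁ homX α ≫ μ[b.X]) ⊵ₗ m.X ≫ resπ α β m :=
  (ext_condition α ((restrict M β).obj m)).trans (Category.assoc _ _ _)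

lemma act_extπ (γ' : a ⟶ b) (m : Mod M a.X) : b.X ⊴ₗ γ[a.X, m.X] ≫ extπ γ' m =
    (αₗ b.X a.X m.X).inv ≫ (b.X ◁ homX γ' ≫ μ[b.X]) ⊵ₗ m.X ≫ extπ γ' m :=
  (ext_condition γ' m).trans (Category.assoc _ _ _)

variable {α β m} in
lemma resπ_hom_ext {x : M} {f g : extX α ((restrict M β).obj m) ⟶ x}
    (h : resπ α β m ≫ f = resπ α β m ≫ g) : f = g := coequalizer.hom_ext h

/-- The map out of `b ⊠_a m` for a `c`-module `m` restricted along `a ⟶ c`. -/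
noncomputable def resDesc {x : M} (f : b.X ⊙ₗ m.X ⟶ x) (h : b.X ⊴ₗ resAct β m ≫ f =
    (αₗ b.X a.X m.X).inv ≫ (b.X ◁ homX α ≫ μ[b.X]) ⊵ₗ m.X ≫ f) :
    extX α ((restrict M β).obj m) ⟶ x :=
  coequalizer.desc f (h.trans (Category.assoc _ _ _).symm)

lemma resπ_desc {x : M} (f : b.X ⊙ₗ m.X ⟶ x) (h) : resπ α β m ≫ resDesc α β m f h = f :=
  coequalizer.π_desc _ _

variable {d : CommMon C} (i : b ⟶ d) (j : c ⟶ d) (w : α ≫ i = β ≫ j)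

variable {α β} in
include w in
-- Since the square commutes, `a` acts on `d` through `b` in the same way as through `c`, and the
-- latter action can be moved across the tensor product over `c`.
lemma baseChange_condition :
    b.X ⊴ₗ resAct β m ≫ homX i ⊵ₗ m.X ≫ extπ j m =
      (αₗ b.X a.X m.X).inv ≫ (b.X ◁ homX α ≫ μ[b.X]) ⊵ₗ m.X ≫ homX i ⊵ₗ m.X ≫ extπ j m := by
  have e : (b.X ◁ homX α ≫ μ[b.X]) ≫ homX i =
      homX i ▷ a.X ≫ d.X ◁ homX β ≫ d.X ◁ homX j ≫ μ[d.X] := by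
    rw [Category.assoc, IsMonHom.mul_hom, MonoidalCategory.tensorHom_def, Category.assoc,
      whisker_exchange_assoc, ← MonoidalCategory.whiskerLeft_comp_assoc, ← homX_comp, w,
      homX_comp, MonoidalCategory.whiskerLeft_comp_assoc]
  rw [← comp_actionHomLeft_assoc, e, action_exchange_assoc, resAct, actionHomRight_comp,
    Category.assoc, act_extπ]
  simp only [comp_actionHomLeft, Category.assoc, reassoc_of% assocIso_inv_whiskerRight,
    reassoc_of% assocIso_inv_whiskerLeft]

/-- The base change map `b ⊠_a m ⟶ d ⊠_c m`. -/
noncomputable def baseChangeX : extX α ((restrict M β).obj m) ⟶ extX j m :=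
  resDesc α β m (homX i ⊵ₗ m.X ≫ extπ j m) (baseChange_condition m i j w)

lemma resπ_baseChangeX :
    resπ α β m ≫ baseChangeX α β m i j w = homX i ⊵ₗ m.X ≫ extπ j m := resπ_desc _ _ _ _ _

variable [CocontinuousAction C M]

lemma resπ_map {m m' : Mod M c.X} (φ : m ⟶ m') :
    resπ α β m ≫ extMapX α ((restrict M β).map φ) = b.X ⊴ₗ φ.hom ≫ resπ α β m' :=
  extπ_map α ((restrict M β).map φ)

lemma baseChangeX_naturality {m m' : Mod M c.X} (φ : m ⟶ m') :
    extMapX α ((restrict M β).map φ) ≫ baseChangeX α β m' i j w =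
      baseChangeX α β m i j w ≫ extMapX j φ := by
  apply resπ_hom_ext
  rw [reassoc_of% resπ_map, resπ_baseChangeX, reassoc_of% resπ_baseChangeX, extπ_map, action_exchange_assoc]

end

section

variable [MonoidalClosed C] [HasColimits C] [CocontinuousAction C M] (m : Mod M c.X)

/-- The underlying map of the projection `b ⊗ c ⟶ b ⊗_a c`. -/
noncomputable def tensorOverπX : b.X ⊗ c.X ⟶ (tensorOver α β).X := homX (tensorOverπ α β)

lemma tensorOverπX_eq : tensorOverπX α β = homX (tensorOverInl α β) ▷ c.X ≫
    (tensorOver α β).X ◁ homX (tensorOverInr α β) ≫ μ[(tensorOver α β).X] := by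
  rw [tensorOverπX, tensorOverπ_eq, homX_coprodDesc, MonoidalCategory.tensorHom_def]
  exact Category.assoc _ _ _

lemma homX_tensorOverInl : homX (tensorOverInl α β) =
    (ρ_ b.X).inv ≫ b.X ◁ η[c.X] ≫ tensorOverπX α β := by
  rw [← id_tensorHom]
  exact Category.assoc _ _ _

/-- The projection `b ⊗ c ⟶ b ⊗_a c` is linear for the right action of `c`. The proof rests on the
fact that `poSnd`, taken for the identity of `c`, multiplies the last two factors of `(b ⊗ c) ⊗ c`.
-/
lemma tensorOverπX_mul :
    tensorOverπX α β ▷ c.X ≫ (tensorOver α β).X ◁ homX (tensorOverInr α β) ≫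
      μ[(tensorOver α β).X] = (α_ b.X c.X c.X).hom ≫ b.X ◁ μ[c.X] ≫ tensorOverπX α β := by
  have h : poSnd b (𝟙 c) ≫ tensorOverπ α β =
      coprodDesc (tensorOverπ α β) (tensorOverInr α β) := by
    rw [poSnd, coprodDesc_comp, Category.id_comp, coprodDesc_inl_inr, Category.id_comp]
    rfl
  have h' := congrArg homX h
  rw [homX_comp, homX_poSnd, homX_coprodDesc, homX_id, id_whiskerRight, Category.id_comp] at h'
  change ((α_ b.X c.X c.X).hom ≫ b.X ◁ μ[c.X]) ≫ tensorOverπX α β =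
    (tensorOverπX α β ⊗ₘ homX (tensorOverInr α β)) ≫ μ[(tensorOver α β).X] at h'
  rw [← Category.assoc (α_ b.X c.X c.X).hom, h', MonoidalCategory.tensorHom_def, Category.assoc]

/-- The functor `- ⊠ x` on commutative monoids. -/
def commMonAction (C : Type u₁) [Category.{v} C] [MonoidalCategory C] [SymmetricCategory C]
    [MonoidalLeftAction C M] (x : M) : CommMon C ⥤ M :=
  CommMon.forget C ⋙ actionRight C x

instance (x : M) :
    PreservesColimit (parallelPair (poFst c α) (poSnd b β)) (commMonAction C x) :=
  inferInstanceAs (PreservesColimit _ (CommMon.forget C ⋙ actionRight C x))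

/-- The image of the coequalizer `b ⊗_a c` under `- ⊠ x` is a coequalizer. -/
noncomputable def isColimitTensorOverAction (x : M) :=
  isColimitOfHasCoequalizerOfPreservesColimit (commMonAction C x) (poFst c α) (poSnd b β)

instance (x : M) : Epi (tensorOverπX α β ⊵ₗ x) :=
  epi_of_isColimit_cofork (isColimitTensorOverAction α β x)

omit [HasColimits M] [MonoidalClosed C] [HasColimits C] [CocontinuousAction C M] in
lemma poFst_action (x : M) : (commMonAction C x).map (poFst c α) =
    ((b.X ◁ homX α ≫ μ[b.X]) ▷ c.X) ⊵ₗ x := congrArg (· ⊵ₗ x) (homX_poFst α)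

omit [HasColimits M] [MonoidalClosed C] [HasColimits C] [CocontinuousAction C M] in
lemma poSnd_action (x : M) : (commMonAction C x).map (poSnd b β) =
    ((α_ b.X a.X c.X).hom ≫ b.X ◁ (homX β ▷ c.X ≫ μ[c.X])) ⊵ₗ x :=
  congrArg (· ⊵ₗ x) (homX_poSnd β)

section

variable (x : M) {y : M} (f : (b.X ⊗ c.X) ⊙ₗ x ⟶ y)
  (h : ((b.X ◁ homX α ≫ μ[b.X]) ▷ c.X) ⊵ₗ x ≫ f =
      ((α_ b.X a.X c.X).hom ≫ b.X ◁ (homX β ▷ c.X ≫ μ[c.X])) ⊵ₗ x ≫ f)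

/-- A map out of `(b ⊗_a c) ⊠ x`. -/
noncomputable def tensorOverActDesc : (tensorOver α β).X ⊙ₗ x ⟶ y :=
  Cofork.IsColimit.desc (isColimitTensorOverAction α β x) f
    ((congrArg (· ≫ f) (poFst_action α x)).trans
      (h.trans (congrArg (· ≫ f) (poSnd_action β x)).symm))

omit [HasColimits M] in
lemma tensorOverActDesc_fac :
    tensorOverπX α β ⊵ₗ x ≫ tensorOverActDesc α β x f h = f :=
  Cofork.IsColimit.π_desc' (isColimitTensorOverAction α β x) _ _

end

/-- The map `(b ⊗ c) ⊠ m ⟶ b ⊠_a m` given by the action on `m`. -/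
noncomputable def unbaseChangeAux : (b.X ⊗ c.X) ⊙ₗ m.X ⟶ extX α ((restrict M β).obj m) :=
  (αₗ b.X c.X m.X).hom ≫ b.X ⊴ₗ γ[c.X, m.X] ≫ resπ α β m

omit [MonoidalClosed C] [HasColimits C] [CocontinuousAction C M] in
-- Associativity of the action on `m`, with a parameter `f` so that it serves twice: `f = homX β`
-- gives the balance over `a` needed to descend to `b ⊗_a c`, and `f = 𝟙` gives the balance over `c`
-- needed to descend to the tensor product over `c`.
lemma mul_unbaseChangeAux {a' : C} (f : a' ⟶ c.X) :
    ((α_ b.X a' c.X).hom ≫ b.X ◁ (f ▷ c.X ≫ μ[c.X])) ⊵ₗ m.X ≫ unbaseChangeAux α β m =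
      (αₗ (b.X ⊗ a') c.X m.X).hom ≫ (b.X ⊗ a') ⊴ₗ γ[c.X, m.X] ≫ (b.X ◁ f) ⊵ₗ m.X ≫
        unbaseChangeAux α β m := by
  have h : (f ▷ c.X ≫ μ[c.X]) ⊵ₗ m.X ≫ γ[c.X, m.X] =
      (αₗ a' c.X m.X).hom ≫ a' ⊴ₗ γ[c.X, m.X] ≫ f ⊵ₗ m.X ≫ γ[c.X, m.X] := by
    rw [comp_actionHomLeft, Category.assoc, ModObj.mul_smul, reassoc_of% whiskerRight_assocIso_hom,
      action_exchange_assoc]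
  rw [unbaseChangeAux, reassoc_of% whiskerLeft_assocIso_hom, comp_actionHomLeft, Category.assoc,
    reassoc_of% whiskerLeft_assocIso_hom, ← actionHomRight_comp_assoc, h, tensor_actionHomRight]
  simp only [Category.assoc, Iso.inv_hom_id_assoc, actionHomRight_comp,
    associator_actionHom_assoc]

omit [MonoidalClosed C] [HasColimits C] [CocontinuousAction C M] in
lemma unbaseChange_condition₁ :
    ((b.X ◁ homX α ≫ μ[b.X]) ▷ c.X) ⊵ₗ m.X ≫ unbaseChangeAux α β m =
      ((α_ b.X a.X c.X).hom ≫ b.X ◁ (homX β ▷ c.X ≫ μ[c.X])) ⊵ₗ m.X ≫ unbaseChangeAux α β m := by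
  rw [mul_unbaseChangeAux, unbaseChangeAux, whiskerLeft_actionHomLeft_assoc,
    Iso.inv_hom_id_assoc, ← actionHomRight_comp_assoc, ← resAct, resπ_condition,
    reassoc_of% whiskerRight_assocIso_hom, ← action_exchange_assoc,
    tensor_actionHomRight]
  simp only [Category.assoc, Iso.hom_inv_id_assoc]

/-- The map `(b ⊗_a c) ⊠ m ⟶ b ⊠_a m`. -/
noncomputable def unbaseChange : (tensorOver α β).X ⊙ₗ m.X ⟶ extX α ((restrict M β).obj m) :=
  tensorOverActDesc α β m.X (unbaseChangeAux α β m) (unbaseChange_condition₁ α β m)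

lemma tensorOverπX_unbaseChange :
    tensorOverπX α β ⊵ₗ m.X ≫ unbaseChange α β m = unbaseChangeAux α β m :=
  tensorOverActDesc_fac _ _ _ _ _

lemma unbaseChange_condition₂ :
    (tensorOver α β).X ⊴ₗ γ[c.X, m.X] ≫ unbaseChange α β m =
      (αₗ (tensorOver α β).X c.X m.X).inv ≫
        ((tensorOver α β).X ◁ homX (tensorOverInr α β) ≫ μ[(tensorOver α β).X]) ⊵ₗ m.X ≫
          unbaseChange α β m := by
  have h := mul_unbaseChangeAux α β m (𝟙 c.X)
  rw [id_whiskerRight, Category.id_comp, MonoidalCategory.whiskerLeft_id, id_actionHomLeft,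
    Category.id_comp] at h
  rw [← cancel_epi (tensorOverπX α β ⊵ₗ (c.X ⊙ₗ m.X)), ← action_exchange_assoc,
    tensorOverπX_unbaseChange, ← reassoc_of% assocIso_inv_whiskerRight, ← comp_actionHomLeft_assoc,
    tensorOverπX_mul, ← Category.assoc (α_ b.X c.X c.X).hom,
    comp_actionHomLeft_assoc _ (tensorOverπX α β), tensorOverπX_unbaseChange, h,
    Iso.inv_hom_id_assoc]

/-- The inverse of the base change map. -/
noncomputable def unbaseChangeX :
    extX (tensorOverInr α β) m ⟶ extX α ((restrict M β).obj m) :=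
  coequalizer.desc (unbaseChange α β m)
    ((unbaseChange_condition₂ α β m).trans (Category.assoc _ _ _).symm)

lemma extπ_unbaseChangeX :
    extπ (tensorOverInr α β) m ≫ unbaseChangeX α β m = unbaseChange α β m :=
  coequalizer.π_desc _ _

/-- Extension of scalars commutes with base change. -/
noncomputable def baseChangeIso :
    extX α ((restrict M β).obj m) ≅ extX (tensorOverInr α β) m where
  hom := baseChangeX α β m _ _ (tensorOver_w α β)
  inv := unbaseChangeX α β m
  hom_inv_id := by
    apply resπ_hom_ext
    rw [reassoc_of% resπ_baseChangeX, extπ_unbaseChangeX, homX_tensorOverInl, comp_actionHomLeft_assoc,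
      comp_actionHomLeft_assoc, tensorOverπX_unbaseChange, unbaseChangeAux,
      whiskerLeft_actionHomLeft_assoc, Iso.inv_hom_id_assoc, ← actionHomRight_comp_assoc,
      ModObj.one_smul, ← rightUnitor_actionHom_assoc, ← comp_actionHomLeft_assoc, Iso.inv_hom_id]
    simp
  inv_hom_id := by
    rw [← cancel_epi (extπ (tensorOverInr α β) m), reassoc_of% extπ_unbaseChangeX,
      ← cancel_epi (tensorOverπX α β ⊵ₗ m.X), reassoc_of% tensorOverπX_unbaseChange, unbaseChangeAux,
      Category.assoc, Category.assoc, resπ_baseChangeX, action_exchange_assoc, act_extπ,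
      ← reassoc_of% assocIso_inv_whiskerRight, Iso.hom_inv_id_assoc, ← comp_actionHomLeft_assoc,
      ← tensorOverπX_eq, Category.comp_id]

variable {α}

/-- By `baseChangeIso`, extension along `c ⟶ b ⊗_a c` is, on underlying objects, restriction to `a`
followed by extension to `b`. Restriction is left exact because it does not change underlying
objects. -/
lemma IsFlat.baseChange [HasFiniteLimits M] (hα : IsFlat M α) :
    IsFlat M (tensorOverInr α β) := by
  have : PreservesFiniteLimits (extFunctor M α) := hα
  have : PreservesFiniteLimits (extFunctor M α ⋙ Mod.forget b.X) := comp_preservesFiniteLimits _ _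
  have : PreservesFiniteLimits (restrict M β ⋙ extFunctor M α ⋙ Mod.forget b.X) :=
    comp_preservesFiniteLimits _ _
  have e : restrict M β ⋙ extFunctor M α ⋙ Mod.forget b.X ≅
      extFunctor M (tensorOverInr α β) ⋙ Mod.forget _ :=
    NatIso.ofComponents (fun m => baseChangeIso α β m)
      (fun φ => baseChangeX_naturality α β _ _ (tensorOver_w α β) φ)
  exact (preservesFiniteLimits_iff_comp_forget _).2 (preservesFiniteLimits_of_natIso e)

end

end FlatBaseChange
-- Epimorphisms of finite type
section FiniteType

variable {C : Type u₁} [Category.{v} C] [MonoidalCategory C] [BraidedCategory C]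
variable {a b c : CommMon C}

/-- Finite type phrased for diagrams of commutative monoids with compatible maps from `a`, which
avoids working with diagrams in the coslice category. -/
lemma IsFiniteType.exists_hom {α : a ⟶ b} (h : IsFiniteType α) {J : Type v} [SmallCategory J]
    [IsFiltered J] {F : J ⥤ CommMon C} {t : Cocone F} (ht : IsColimit t)
    (s : ∀ j, a ⟶ F.obj j) (hs : ∀ {i j} (u : i ⟶ j), s i ≫ F.map u = s j) (f : b ⟶ t.pt)
    (hf : ∀ j, s j ≫ t.ι.app j = α ≫ f) :
    ∃ (j : J) (q : b ⟶ F.obj j), α ≫ q = s j ∧ q ≫ t.ι.app j = f :=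
  have : IsFinitelyPresentable.{v} (Under.mk α) :=
    isFinitelyPresentable_iff_preservesFilteredColimits.2 h
  IsFinitelyPresentable.exists_hom_of_isColimit_under ht α
    { app := s
      naturality _ _ u := (Category.id_comp _).trans (hs u).symm } f hf

/-- An epimorphism of commutative monoids is of finite type if maps from its target to a filtered
colimit factor through a stage of the diagram. -/
lemma IsFiniteType.of_epi {α : a ⟶ b} [Epi α]
    (h : ∀ {J : Type v} [SmallCategory J] [IsFiltered J] {F : J ⥤ CommMon C} {t : Cocone F}
      (_ : IsColimit t) (s : ∀ j, a ⟶ F.obj j) (_ : ∀ {i j} (u : i ⟶ j), s i ≫ F.map u = s j)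
      (f : b ⟶ t.pt) (_ : ∀ j, s j ≫ t.ι.app j = α ≫ f),
      ∃ (j : J) (q : b ⟶ F.obj j), α ≫ q = s j ∧ q ≫ t.ι.app j = f) : IsFiniteType α := by
  refine ⟨fun J _ _ => ⟨fun {F} => ⟨fun {t} ht => ⟨?_⟩⟩⟩⟩
  have := IsFiltered.isConnected J
  -- Because `α` is an epimorphism, each object under `a` receives at most one map from `b`.
  -- Injectivity of the comparison of Hom sets is therefore automatic and only surjectivity uses
  -- `h`.
  have uniq {x : Under a} (f g : Under.mk α ⟶ x) : f = g :=
    Under.UnderMorphism.ext ((cancel_epi α).1 ((Under.w f).trans (Under.w g).symm))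
  refine Types.FilteredColimit.isColimitOf _ _ (fun f => ?_) (fun i j _ _ _ => ?_)
  · obtain ⟨j, q, h₁, h₂⟩ := h (isColimitOfPreserves (Under.forget a) ht)
      (fun j => (F.obj j).hom) (fun u => Under.w (F.map u))
      (CommaMorphism.right f) (fun j => (Under.w (t.ι.app j)).trans (Under.w f).symm)
    exact ⟨j, Under.homMk q h₁, uniq _ _⟩
  · exact ⟨IsFiltered.max i j, IsFiltered.leftToMax i j, IsFiltered.rightToMax i j, uniq _ _⟩

lemma IsFiniteType.id (a : CommMon C) : IsFiniteType (𝟙 a) := by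
  refine .of_epi fun {J} _ _ _ _ _ s _ f hf => ?_
  have j : J := IsFiltered.nonempty.some
  exact ⟨j, s j, Category.id_comp _, (hf j).trans (Category.id_comp _)⟩

/-- The map from `b` factors through some stage `j`. The stages after `j` then lie under `b`, and
they are final in the diagram, so finiteness of `β` applies to them. -/
lemma IsFiniteType.comp {α : a ⟶ b} {β : b ⟶ c} [Epi α] [Epi β] (hα : IsFiniteType α)
    (hβ : IsFiniteType β) : IsFiniteType (α ≫ β) :=
  .of_epi fun {J} _ _ F t ht s hs f hf => by
    obtain ⟨j, q, h₁, h₂⟩ := hα.exists_hom ht s hs (β ≫ f) (fun j => by rw [hf, Category.assoc])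
    obtain ⟨k, r, h₃, h₄⟩ := hβ.exists_hom
      ((Functor.Final.isColimitWhiskerEquiv (Under.forget j) t).symm ht)
      (fun k => q ≫ F.map k.hom) (fun {k l} u => by
        change (q ≫ F.map k.hom) ≫ F.map u.right = q ≫ F.map l.hom
        rw [Category.assoc, ← F.map_comp, Under.w]) f (fun k => by
        change (q ≫ F.map k.hom) ≫ t.ι.app k.right = β ≫ f
        rw [Category.assoc, t.w, h₂])
    refine ⟨k.right, r, ?_, h₄⟩
    refine (Category.assoc _ _ _).trans ((congrArg (α ≫ ·) h₃).trans ?_)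
    change α ≫ q ≫ F.map k.hom = _
    rw [reassoc_of% h₁, hs]

lemma epi_of_isPushout {X : Type u₁} [Category.{v} X] {a b c d : X} {α : a ⟶ b} {β : a ⟶ c}
    {i : b ⟶ d} {j : c ⟶ d} (sq : IsPushout α β i j) [Epi α] : Epi j where
  left_cancellation f g h := by
    apply sq.hom_ext _ h
    rw [← cancel_epi α, sq.w_assoc, sq.w_assoc, h]

/-- A map out of the pushout is a pair of maps. The component on `c` is given at every stage, so
only the component on `b` has to be factored. -/
lemma IsFiniteType.of_isPushout {d : CommMon C} {α : a ⟶ b} {β : a ⟶ c} {i : b ⟶ d} {j : c ⟶ d}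
    (sq : IsPushout α β i j) [Epi α] (hα : IsFiniteType α) : IsFiniteType j :=
  have : Epi j := epi_of_isPushout sq
  .of_epi fun {J} _ _ F t ht s hs f hf => by
    obtain ⟨k, q, h₁, h₂⟩ := hα.exists_hom ht (fun k => β ≫ s k)
      (fun u => by rw [Category.assoc, hs]) (i ≫ f)
      (fun k => by rw [Category.assoc, hf, sq.w_assoc])
    refine ⟨k, sq.desc q (s k) h₁, sq.inr_desc _ _ _, ?_⟩
    apply sq.hom_ext
    · exact (sq.inl_desc_assoc _ _ _ _).trans h₂
    · exact (sq.inr_desc_assoc _ _ _ _).trans (hf k)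

/-- The factorization problem is transposed along the adjunction; `G` preserves the filtered
colimit, so finiteness of `α` solves it. -/
lemma IsFiniteType.map {D : Type u₂} [Category.{v} D] [MonoidalCategory D] [BraidedCategory D]
    {F : CommMon C ⥤ CommMon D} {G : CommMon D ⥤ CommMon C} (adj : F ⊣ G)
    [PreservesFilteredColimits G] {α : a ⟶ b} [Epi α] (hα : IsFiniteType α) :
    IsFiniteType (F.map α) :=
  have := adj.isLeftAdjoint
  .of_epi fun {J} _ _ K t ht s hs f hf => by
    obtain ⟨j, q, h₁, h₂⟩ := hα.exists_hom (isColimitOfPreserves G ht)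
      (fun j => adj.homEquiv _ _ (s j))
      (fun {i j} u => by
        change adj.homEquiv _ _ (s i) ≫ G.map (K.map u) = _
        rw [← adj.homEquiv_naturality_right, hs])
      (adj.homEquiv _ _ f) (fun j => by
        change adj.homEquiv _ _ (s j) ≫ G.map (t.ι.app j) = _
        rw [← adj.homEquiv_naturality_right, hf, adj.homEquiv_naturality_left]
        rfl)
    refine ⟨j, (adj.homEquiv _ _).symm q, ?_, ?_⟩
    · rw [← adj.homEquiv_naturality_left_symm, h₁]
      exact (adj.homEquiv _ _).symm_apply_apply _
    · rw [← adj.homEquiv_naturality_right_symm]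
      exact (congrArg _ h₂).trans ((adj.homEquiv _ _).symm_apply_apply _)

end FiniteType

/-! ### Composition and base change of spectral immersions -/

section SpectralImmersion

section

variable {C : Type u₁} [Category.{v} C] [MonoidalCategory C] [BraidedCategory C]
variable {M : Type u₃} [Category.{v} M] [MonoidalLeftAction C M] [HasColimits M]
  [CocontinuousAction C M]
variable {X Y Z : Aff C}

variable (M X) in
lemma IsSpectralImmersion.id : IsSpectralImmersion M (𝟙 X) where
  flat := IsFlat.id M X.unop
  epi := inferInstanceAs (Epi (𝟙 X.unop))
  finiteType := IsFiniteType.id X.unop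

lemma IsSpectralImmersion.comp {f : X ⟶ Y} {g : Y ⟶ Z} (hf : IsSpectralImmersion M f)
    (hg : IsSpectralImmersion M g) : IsSpectralImmersion M (f ≫ g) :=
  have := hf.epi
  have := hg.epi
  { flat := hg.flat.comp M hf.flat
    epi := epi_comp g.unop f.unop
    finiteType := hg.finiteType.comp hf.finiteType }

end

section

variable {C : Type u₁} [Category.{v} C] [MonoidalCategory C] [SymmetricCategory C]
  [MonoidalClosed C] [HasColimits C]
variable {M : Type u₃} [Category.{v} M] [MonoidalLeftAction C M] [HasColimits M]
  [CocontinuousAction C M] [HasFiniteLimits M]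

/-- Spectral immersions have base changes which are spectral immersions. -/
lemma IsSpectralImmersion.exists_isPullback {X Y Z : Aff C} {f : Y ⟶ X}
    (hf : IsSpectralImmersion M f) (g : Z ⟶ X) :
    ∃ (P : Aff C) (p : P ⟶ Y) (q : P ⟶ Z), IsPullback p q f g ∧ IsSpectralImmersion M q :=
  have : Epi f.unop := hf.epi
  ⟨op (tensorOver f.unop g.unop), (tensorOverInl f.unop g.unop).op,
    (tensorOverInr f.unop g.unop).op, (tensorOver_isPushout f.unop g.unop).flip.op,
    { flat := hf.flat.baseChange g.unop
      epi := epi_of_isPushout (tensorOver_isPushout f.unop g.unop)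
      finiteType := hf.finiteType.of_isPushout (tensorOver_isPushout f.unop g.unop) }⟩

end

end SpectralImmersion

/-! ### Covering sieves and spectral immersions -/

section Covers

variable {C : Type u₁} [Category.{v} C] [MonoidalCategory C] [BraidedCategory C]
variable {M : Type u₃} [Category.{v} M] [MonoidalLeftAction C M] [HasColimits M]
  [CocontinuousAction C M]

/-- The sieve generated by a spectral cover is covering, for index types in any universe. -/
lemma IsSpectralCover.ofArrows_mem {I : Type t} {X : Aff C} {Y : I → Aff C} {f : ∀ i, Y i ⟶ X}
    (h : IsSpectralCover M Y f) : Sieve.ofArrows Y f ∈ spectralTopology C M X := by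
  obtain ⟨J, hJ⟩ := h.isFpqcCover.conservative
  -- The generating covers have index types in a fixed universe. The finite jointly conservative
  -- subfamily can be reindexed there, is itself a spectral cover, and generates a smaller sieve.
  let e (k : ULift.{max u₁ v} (Fin J.card)) : I := J.equivFin.symm k.down
  refine (spectralTopology C M).superset_covering ?_
    (Precoverage.generate_mem_toGrothendieck
      ⟨_, fun k => Y (e k), fun k => f (e k),
        { isFpqcCover :=
            { flat := fun k => h.isFpqcCover.flat (e k)
              conservative := ⟨Finset.univ, fun φ hφ => hJ φ fun j hj => by
                have h : e ⟨J.equivFin ⟨j, hj⟩⟩ = j :=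
                  congrArg Subtype.val (J.equivFin.symm_apply_apply ⟨j, hj⟩)
                rw [← h]
                exact hφ ⟨J.equivFin ⟨j, hj⟩⟩ (Finset.mem_univ _)⟩ }
          isSpectralImmersion := fun k => h.isSpectralImmersion (e k) }, rfl⟩)
  rw [Sieve.generate_le_iff]
  rintro _ _ ⟨k⟩
  exact Sieve.ofArrows_mk _ _ _

/-- The sieve of morphisms factoring through a spectral immersion in a given sieve. -/
def spectralPart (M : Type u₃) [Category.{v} M] [MonoidalLeftAction C M] [HasColimits M]
    [CocontinuousAction C M] {X : Aff C} (S : Sieve X) : Sieve X where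
  arrows Z g := ∃ (W : Aff C) (k : Z ⟶ W) (i : W ⟶ X), IsSpectralImmersion M i ∧ S i ∧ k ≫ i = g
  downward_closed := by
    rintro Z Z' _ ⟨W, k, i, hi, hS, rfl⟩ h
    exact ⟨W, h ≫ k, i, hi, hS, Category.assoc _ _ _⟩

end Covers

section

variable {C : Type u₁} [Category.{v} C] [MonoidalCategory C] [SymmetricCategory C]
  [MonoidalClosed C] [HasColimits C]
variable {M : Type u₃} [Category.{v} M] [MonoidalLeftAction C M] [HasColimits M]
  [CocontinuousAction C M] [HasFiniteLimits M]

/-- A covering sieve contains a covering sieve generated by spectral immersions. -/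
lemma spectralPart_mem {X : Aff C} {S : Sieve X} (hS : S ∈ spectralTopology C M X) :
    spectralPart M S ∈ spectralTopology C M X := by
  -- Membership in the generated topology is an inductive predicate, which permits induction on how
  -- `S` was obtained.
  replace hS : (spectralPrecoverage C M).Saturate X S := hS
  induction hS with
  | of X S hS =>
    refine (spectralTopology C M).superset_covering ?_ (Precoverage.generate_mem_toGrothendieck hS)
    obtain ⟨I, Y, f, hf, rfl⟩ := hS
    rw [Sieve.generate_le_iff]
    rintro _ _ ⟨i⟩
    exact ⟨_, 𝟙 _, _, hf.isSpectralImmersion i, Sieve.ofArrows_mk _ _ i, Category.id_comp _⟩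
  | top X =>
    refine (spectralTopology C M).superset_covering ?_ ((spectralTopology C M).top_mem X)
    intro Z g _
    exact ⟨X, g, 𝟙 X, .id M X, trivial, Category.comp_id g⟩
  | pullback X S _ Y f ih =>
    refine (spectralTopology C M).superset_covering ?_
      ((spectralTopology C M).pullback_stable f ih)
    rintro Z h ⟨W, k, i, hi, hS, e⟩
    -- The immersion into `X` is replaced by its base change along `f`; it lies in the pulled back
    -- sieve because the square commutes.
    obtain ⟨P, p, q, sq, hq⟩ := hi.exists_isPullback f
    refine ⟨P, sq.lift k h e, q, hq, ?_, sq.lift_snd _ _ _⟩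
    change S (q ≫ f)
    rw [← sq.w]
    exact S.downward_closed hS p
  | transitive X S R _ _ ih₁ ih₂ =>
    refine (spectralTopology C M).transitive ih₁ _ ?_
    rintro Z _ ⟨W, k, i, hi, hS, rfl⟩
    rw [Sieve.pullback_comp]
    refine (spectralTopology C M).pullback_stable k
      ((spectralTopology C M).superset_covering ?_ (ih₂ hS))
    rintro V _ ⟨U, k', i', hi', hR, rfl⟩
    exact ⟨U, k', i' ≫ i, hi'.comp hi, hR, (Category.assoc _ _ _).symm⟩

end

/-! ### Continuity of `B^op` -/

section

variable {C : Type u₁} [Category.{v} C] [MonoidalCategory C] [SymmetricCategory C]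
  [MonoidalClosed C] [HasColimits C]
variable {D : Type u₂} [Category.{v} D] [MonoidalCategory D] [SymmetricCategory D]
  [MonoidalClosed D] [HasColimits D]
variable {B : C ⥤ D} [B.Braided] {A : D ⥤ C} (adj : B ⊣ A)

/-- The adjunction between the functors on affine schemes. -/
noncomputable def affAdjunction : Aop adj ⊣ Bop B :=
  letI := rightAdjointLaxBraided adj
  have : adj.IsMonoidal := inferInstance
  adj.mapCommMon.op

variable {M : Type u₃} [Category.{v} M] [MonoidalLeftAction C M] [HasColimits M]
  [CocontinuousAction C M] [HasFiniteLimits M]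
variable {N : Type u₄} [Category.{v} N] [MonoidalLeftAction D N] [HasColimits N]
  [CocontinuousAction D N] [HasFiniteLimits N]
variable (L : N ⥤ M) [LaxLinearAlong B L] [L.ReflectsIsomorphisms] [PreservesFiniteLimits L]

include adj in
lemma IsSpectralImmersion.map [PreservesFilteredColimits A]
    (hθ : ∀ {a b : CommMon C} (α : a ⟶ b), IsFlat M α →
      ∀ n : Mod N (B.mapCommMon.obj a).X, IsIso (theta B L α n))
    {X Y : Aff C} {f : Y ⟶ X} (hf : IsSpectralImmersion M f) :
    IsSpectralImmersion N ((Bop B).map f) := by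
  let := rightAdjointLaxBraided adj
  have : adj.IsMonoidal := inferInstance
  have := preservesFilteredColimits_mapCommMon A
  have : Epi f.unop := hf.epi
  have := adj.mapCommMon.isLeftAdjoint
  exact
    { flat := isFlat_map B L (hθ f.unop hf.flat) hf.flat
      epi := inferInstanceAs (Epi (B.mapCommMon.map f.unop))
      finiteType := hf.finiteType.map adj.mapCommMon }

include adj in
lemma IsSpectralCover.map [PreservesFilteredColimits A]
    (hθ : ∀ {a b : CommMon C} (α : a ⟶ b), IsFlat M α →
      ∀ n : Mod N (B.mapCommMon.obj a).X, IsIso (theta B L α n))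
    {I : Type t} {X : Aff C} {Y : I → Aff C} {f : ∀ i, Y i ⟶ X} (hf : IsSpectralCover M Y f) :
    IsSpectralCover N (fun i => (Bop B).obj (Y i)) (fun i => (Bop B).map (f i)) where
  isFpqcCover := hf.isFpqcCover.map B L hθ
  isSpectralImmersion i := (hf.isSpectralImmersion i).map adj L hθ

/-- A map `h` into `F y` equals the unit followed by `F` of its transpose. Transposing the
factorization of `h ≫ F f` shows that this transpose lies in the pulled back sieve. -/
lemma functorPushforward_pullback_le {X Y : Type*} [Category X] [Category Y] {F : X ⥤ Y}
    {G : Y ⥤ X} (adj : G ⊣ F) {x y : X} (f : y ⟶ x) (S : Sieve x) :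
    (S.functorPushforward F).pullback (F.map f) ≤ (S.pullback f).functorPushforward F := by
  rintro z h ⟨w, s, k, hs, e⟩
  refine ⟨G.obj z, (adj.homEquiv _ _).symm h, adj.unit.app z, ?_, ?_⟩
  · change S ((adj.homEquiv _ _).symm h ≫ f)
    rw [← adj.homEquiv_naturality_right_symm, e, adj.homEquiv_naturality_right_symm]
    exact S.downward_closed hs _
  · rw [← adj.homEquiv_unit, Equiv.apply_symm_apply]

include adj in
-- Induction on the generation of the covering sieve. The generators are spectral covers, which `B`
-- preserves; the pullback case is where `B^op` being a right adjoint enters.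
lemma coverPreserving_Bop [PreservesFilteredColimits A]
    (hθ : ∀ {a b : CommMon C} (α : a ⟶ b), IsFlat M α →
      ∀ n : Mod N (B.mapCommMon.obj a).X, IsIso (theta B L α n)) :
    CoverPreserving (spectralTopology C M) (spectralTopology D N) (Bop B) where
  cover_preserve {X S} hS := by
    replace hS : (spectralPrecoverage C M).Saturate X S := hS
    induction hS with
    | of X S hS =>
      obtain ⟨I, Y, f, hf, rfl⟩ := hS
      refine (spectralTopology D N).superset_covering ?_ (hf.map adj L hθ).ofArrows_mem
      rw [Sieve.ofArrows, Sieve.generate_le_iff]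
      rintro _ _ ⟨i⟩
      exact Sieve.image_mem_functorPushforward (Bop B) (Sieve.ofArrows _ f)
        (Sieve.ofArrows_mk _ _ i)
    | top X => rw [Sieve.functorPushforward_top]; exact (spectralTopology D N).top_mem _
    | pullback X S _ Y f ih =>
      exact (spectralTopology D N).superset_covering
        (functorPushforward_pullback_le (affAdjunction adj) f S)
        ((spectralTopology D N).pullback_stable _ ih)
    | transitive X S R _ _ ih₁ ih₂ =>
      refine (spectralTopology D N).transitive ih₁ _ ?_
      rintro Z _ ⟨W, s, k, hs, rfl⟩
      rw [Sieve.pullback_comp]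
      refine (spectralTopology D N).pullback_stable k
        ((spectralTopology D N).superset_covering ?_ (ih₂ hs))
      rintro V _ ⟨U, r, k', hr, rfl⟩
      exact ⟨U, r ≫ s, k', hr, by rw [Functor.map_comp, Category.assoc]⟩

include adj in
lemma isContinuous_Bop [PreservesFilteredColimits A]
    (hθ : ∀ {a b : CommMon C} (α : a ⟶ b), IsFlat M α →
      ∀ n : Mod N (B.mapCommMon.obj a).X, IsIso (theta B L α n)) :
    (Bop B).IsContinuous (spectralTopology C M) (spectralTopology D N) := by
  have := (affAdjunction adj).isRightAdjoint
  exact Functor.isContinuous_iff_coverPreserving.2 (coverPreserving_Bop adj L hθ)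

end

/-! ### Jointly epimorphic families of sheaves -/

section JointlyEpi

variable {E : Type u₁} [Category.{v} E] {J : GrothendieckTopology E} {I : Type t}
  {F : Sheaf J (Type w)} {X : I → Sheaf J (Type w)} (f : ∀ i, X i ⟶ F)

/-- Eliminates the coproduct, so that covers can be restricted, composed and transported as
families. -/
lemma epi_sigmaDesc_iff [HasCoproduct X] :
    Epi (Sigma.desc f) ↔ ∀ {H : Sheaf J (Type w)} (u v : F ⟶ H), (∀ i, f i ≫ u = f i ≫ v) → u = v := by
  refine ⟨fun _ H u v h => ?_, fun h => ⟨fun u v e => h u v fun i => ?_⟩⟩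
  · rw [← cancel_epi (Sigma.desc f)]
    exact Sigma.hom_ext _ _ fun i => by simpa using h i
  · simpa using Sigma.ι X i ≫= e

/-- The union of the images of a family of morphisms of sheaves, as a subpresheaf. -/
def unionRange : Subfunctor F.obj := ⨆ i, Subfunctor.range (f i).hom

lemma mem_unionRange {Z : Eᵒᵖ} (s : F.obj.obj Z) :
    s ∈ (unionRange f).obj Z ↔ ∃ (i : I) (t : (X i).obj.obj Z), (f i).hom.app Z t = s := by
  simp [unionRange]

/-- The union of the images of a family of morphisms of sheaves. -/
def unionImage : Sheaf J (Type w) :=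
  ⟨((unionRange f).sheafify J).toFunctor, by
    rw [isSheaf_iff_isSheaf_of_type]
    exact (unionRange f).sheafify_isSheaf ((isSheaf_iff_isSheaf_of_type _ _).1 F.2)⟩

/-- The inclusion of the union of the images. -/
def unionImageι : unionImage f ⟶ F := ⟨Subfunctor.ι _⟩

instance : Mono (unionImageι f) :=
  (sheafToPresheaf J _).mono_of_mono_map
    (inferInstanceAs (Mono (Subfunctor.ι ((unionRange f).sheafify J))))

/-- The members of the family factor through the union of the images. -/
def toUnionImage (i : I) : X i ⟶ unionImage f :=
  ⟨Subfunctor.lift (f i).hom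
    ((le_iSup (fun i => Subfunctor.range (f i).hom) i).trans (Subfunctor.le_sheafify J _))⟩

lemma toUnionImage_ι (i : I) : toUnionImage f i ≫ unionImageι f = f i := rfl

/-- The inclusion of the union of the images is a monomorphism, and an epimorphism because the
family factors through it. Sheaves of sets form a balanced category, so it is an isomorphism. -/
lemma sheafify_unionRange_eq_top [HasSheafify J (Type w)]
    (h : ∀ {H : Sheaf J (Type w)} (u v : F ⟶ H), (∀ i, f i ≫ u = f i ≫ v) → u = v) :
    (unionRange f).sheafify J = ⊤ := by
  have : Epi (unionImageι f) := ⟨fun u v e => h u v fun i => by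
    rw [← toUnionImage_ι f i, Category.assoc, e, Category.assoc]⟩
  rw [Subfunctor.eq_top_iff_isIso]
  have := isIso_of_mono_of_epi (unionImageι f)
  exact inferInstanceAs (IsIso ((sheafToPresheaf J _).map (unionImageι f)))

end JointlyEpi

/-! ### Local descriptions of epimorphisms and of Zariski open subobjects -/

section Affine

variable {C : Type u₁} [Category.{v} C] [MonoidalCategory C] [BraidedCategory C]
variable {M : Type u₃} [Category.{v} M] [MonoidalLeftAction C M]
  [HasColimits M] [CocontinuousAction C M] [IsSubcanonical C M]

lemma affine_hom_ext {F G : Sh.{w} C M} {u v : F ⟶ G}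
    (h : ∀ (Y : Aff C) (s : (affine.{w} M).obj Y ⟶ F), s ≫ u = s ≫ v) : u = v :=
  (spectralTopology C M).hom_ext_uliftYoneda h

/-- By the Yoneda lemma these maps are sections of `F` over `Y`, and `F` is separated. -/
lemma affine_hom_ext_of_mem {F : Sh.{w} C M} {Y : Aff C} {R : Sieve Y}
    (hR : R ∈ spectralTopology C M Y) {s s' : (affine.{w} M).obj Y ⟶ F}
    (h : ∀ {Z : Aff C} (g : Z ⟶ Y), R g →
      (affine.{w} M).map g ≫ s = (affine.{w} M).map g ≫ s') : s = s' := by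
  apply (spectralTopology C M).uliftYonedaEquiv.injective
  apply (((isSheaf_iff_isSheaf_of_type _ _).1 F.2).isSeparated _ hR).ext
  intro Z g hg
  rw [GrothendieckTopology.uliftYonedaEquiv_naturality,
    GrothendieckTopology.uliftYonedaEquiv_naturality]
  exact congrArg _ (h g hg)

variable {I : Type t} {F : Sh.{w} C M} {X : I → Sh.{w} C M} (f : ∀ i, X i ⟶ F)

/-- The sieve of morphisms along which a section of `F` lifts to one of the `X i`. -/
def factorSieve {Y : Aff C} (s : (affine.{w} M).obj Y ⟶ F) : Sieve Y where
  arrows Z g := ∃ (i : I) (r : (affine.{w} M).obj Z ⟶ X i), r ≫ f i = (affine.{w} M).map g ≫ s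
  downward_closed := by
    rintro Z Z' g ⟨i, r, e⟩ h
    exact ⟨i, (affine M).map h ≫ r, by rw [Category.assoc, e, Functor.map_comp, Category.assoc]⟩

variable {f}

/-- Sections lift locally: the sheafified union of the images is all of `F`, and membership in it
means precisely that lifts exist on a covering sieve. -/
lemma factorSieve_mem
    (h : ∀ {H : Sh.{w} C M} (u v : F ⟶ H), (∀ i, f i ≫ u = f i ≫ v) → u = v)
    {Y : Aff C} (s : (affine.{w} M).obj Y ⟶ F) : factorSieve f s ∈ spectralTopology C M Y := by
  have e := sheafify_unionRange_eq_top f h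
  have hs : (spectralTopology C M).uliftYonedaEquiv s ∈
      ((unionRange f).sheafify (spectralTopology C M)).obj (op Y) := by rw [e]; trivial
  refine (spectralTopology C M).superset_covering ?_ hs
  intro Z g hg
  obtain ⟨i, r, hr⟩ := (mem_unionRange f _).1 hg
  refine ⟨i, (spectralTopology C M).uliftYonedaEquiv.symm r, ?_⟩
  apply (spectralTopology C M).uliftYonedaEquiv.injective
  rw [GrothendieckTopology.uliftYonedaEquiv_comp, Equiv.apply_symm_apply]
  exact hr.trans (GrothendieckTopology.uliftYonedaEquiv_naturality _ _ _)

lemma hom_ext_of_factorSieve_mem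
    (h : ∀ {Y : Aff C} (s : (affine.{w} M).obj Y ⟶ F), factorSieve f s ∈ spectralTopology C M Y)
    {H : Sh.{w} C M} {u v : F ⟶ H} (huv : ∀ i, f i ≫ u = f i ≫ v) : u = v :=
  affine_hom_ext fun Y s => affine_hom_ext_of_mem (h s) fun g ⟨i, r, e⟩ => by
    rw [← reassoc_of% e, huv, reassoc_of% e]

lemma mono_of_affine {F G : Sh.{w} C M} {u : F ⟶ G}
    (h : ∀ (Y : Aff C) (s s' : (affine.{w} M).obj Y ⟶ F), s ≫ u = s' ≫ u → s = s') : Mono u where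
  right_cancellation p q e := affine_hom_ext fun Y s => h Y _ _ (by
    rw [Category.assoc, e, Category.assoc])

/-- Two lifts of one affine section of `G` are two sections of the base change of `f` along it, and
that base change is a monomorphism. -/
lemma IsZariskiOpenImmersion.mono {F G : Sh.{w} C M} {f : F ⟶ G}
    (hf : IsZariskiOpenImmersion f) : Mono f :=
  mono_of_affine fun Y s s' e => by
    obtain ⟨_, -⟩ := hf Y (s ≫ f)
    have h : pullback.lift s (𝟙 _) (Category.id_comp _).symm =
        pullback.lift s' (𝟙 _) (by rw [← e, Category.id_comp]) := by
      rw [← cancel_mono (pullback.snd f (s ≫ f)), pullback.lift_snd, pullback.lift_snd]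
    have h' := h =≫ pullback.fst f (s ≫ f)
    rwa [pullback.lift_fst, pullback.lift_fst] at h'

/-- The sieve of morphisms along which a map to the source of `p` factors through a spectral immersion
which lifts along `p`. -/
def openSieve {X : Aff C} {U : Sh.{w} C M} (p : U ⟶ (affine.{w} M).obj X) {Y : Aff C} (b : Y ⟶ X) :
    Sieve Y where
  arrows Z g := ∃ (W : Aff C) (k : Z ⟶ W) (i : W ⟶ X) (l : (affine.{w} M).obj W ⟶ U),
    IsSpectralImmersion M i ∧ l ≫ p = (affine.{w} M).map i ∧ k ≫ i = g ≫ b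
  downward_closed := by
    rintro Z Z' g ⟨W, k, i, l, hi, hl, e⟩ h
    exact ⟨W, h ≫ k, i, l, hi, hl, by rw [Category.assoc, Category.assoc, e]⟩

/-- A local criterion for openness, which avoids exhibiting a specific cover of `U`. -/
lemma isZariskiOpen_mk {X : Aff C} {U : Sh.{w} C M} (p : U ⟶ (affine.{w} M).obj X) [Mono p]
    (h : ∀ {Y : Aff C} (s : (affine.{w} M).obj Y ⟶ U) (b : Y ⟶ X),
      s ≫ p = (affine.{w} M).map b → openSieve p b ∈ spectralTopology C M Y) :
    IsZariskiOpen (Subobject.mk p) := by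
  -- All spectral immersions into `X` that lift to `U` are used at once; the hypothesis says that
  -- they are jointly epimorphic onto `U`.
  let I : Type (max w u₁ v) := Σ (W : Aff C) (i : W ⟶ X),
    { l : (affine.{w} M).obj W ⟶ U // IsSpectralImmersion M i ∧ l ≫ p = (affine.{w} M).map i }
  let q : (∐ fun i : I => (affine.{w} M).obj i.1) ⟶ U := Sigma.desc fun i : I => i.2.2.1
  have hq : Epi q := by
    refine (epi_sigmaDesc_iff _).2 fun u v e => hom_ext_of_factorSieve_mem (fun {Y} s => ?_) e
    obtain ⟨b, hb⟩ := (affine.{w} M).map_surjective (s ≫ p)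
    refine (spectralTopology C M).superset_covering ?_ (h s b hb.symm)
    rintro Z g ⟨W, k, i, l, hi, hl, e⟩
    refine ⟨⟨W, i, l, hi, hl⟩, (affine M).map k, ?_⟩
    change (affine M).map k ≫ l = (affine M).map g ≫ s
    rw [← cancel_mono p, Category.assoc, Category.assoc, hl, ← hb, ← Functor.map_comp, e,
      Functor.map_comp]
  refine ⟨I, fun i => i.1, fun i => i.2.1, q ≫ (Subobject.underlyingIso p).inv,
    fun i => i.2.2.2.1, epi_comp _ _, ?_⟩
  rw [Category.assoc, Subobject.underlyingIso_arrow]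
  refine Sigma.hom_ext _ _ fun i => ?_
  rw [Sigma.ι_desc, Sigma.ι_desc_assoc]
  exact i.2.2.2.2

/-- A Zariski open subobject is locally a spectral immersion. -/
lemma IsZariskiOpen.exists_cover {X : Aff C} {U : Sh.{w} C M} {p : U ⟶ (affine.{w} M).obj X} [Mono p]
    (h : IsZariskiOpen (Subobject.mk p)) :
    ∃ (I : Type (max w u₁ v)) (Y : I → Aff C) (f : ∀ i, Y i ⟶ X)
      (l : ∀ i, (affine.{w} M).obj (Y i) ⟶ U), (∀ i, IsSpectralImmersion M (f i)) ∧
      (∀ i, l i ≫ p = (affine.{w} M).map (f i)) ∧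
      ∀ {H : Sh.{w} C M} (u v : U ⟶ H), (∀ i, l i ≫ u = l i ≫ v) → u = v := by
  obtain ⟨I, Y, f, q, hf, hq, e⟩ := h
  refine ⟨I, Y, f, fun i => Sigma.ι (fun i => (affine.{w} M).obj (Y i)) i ≫ q ≫ (Subobject.underlyingIso p).hom, hf, fun i => ?_,
    fun u v huv => ?_⟩
  · rw [Category.assoc, Category.assoc, Subobject.underlyingIso_hom_comp_eq_mk, e, Sigma.ι_desc]
  · rw [← cancel_epi (Subobject.underlyingIso p).hom, ← cancel_epi q]
    exact Sigma.hom_ext _ _ fun i => by simpa using huv i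

end Affine

/-- Up to `hU`, the transpose of `φ` is `a` applied to its transpose along `adj₁`, followed by the
counit of `adj₂`. The counit is invertible, so for sheaves it suffices to check the transpose on
presheaves. -/
lemma isIso_restrictFullyFaithful_homEquiv_symm {P : Type*} [Category P] {Q : Type*} [Category Q]
    {S : Type*} [Category S] {R : Type*} [Category R] {G : P ⥤ Q} {H : Q ⥤ P} {a : Q ⥤ S} {i : S ⥤ Q}
    {j : R ⥤ P} {U : R ⥤ S} {V : S ⥤ R} (adj₁ : G ⊣ H) (adj₂ : a ⊣ i) [IsIso adj₂.counit]
    (hj : j.FullyFaithful) (hU : j ⋙ G ⋙ a ≅ U ⋙ 𝟭 S) (hV : i ⋙ H ≅ V ⋙ j) {F : R} {X : S}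
    (φ : F ⟶ V.obj X)
    (h : IsIso ((adj₁.homEquiv _ _).symm (j.map φ ≫ hV.inv.app X))) :
    IsIso ((((adj₁.comp adj₂).restrictFullyFaithful hj (.id S) hU hV).homEquiv F X).symm φ) := by
  have e : (((adj₁.comp adj₂).restrictFullyFaithful hj (.id S) hU hV).homEquiv F X).symm φ =
      hU.inv.app F ≫ (adj₂.homEquiv _ _).symm
        ((adj₁.homEquiv _ _).symm (j.map φ ≫ hV.inv.app X)) := by
    rw [Adjunction.homEquiv_counit, ← Functor.id_map (U.map φ ≫ _), Functor.map_comp]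
    rw [Adjunction.map_restrictFullyFaithful_counit_app]
    have h := hU.inv.naturality φ
    simp only [Functor.comp_map, Functor.id_map] at h
    simp [Adjunction.homEquiv_counit, Adjunction.comp_counit_app, reassoc_of% h]
  rw [e, Adjunction.homEquiv_counit]
  infer_instance

/-! ### The adjunction between sheaf categories and its value on affine schemes -/

section Comparison

variable {C : Type u₁} [Category.{v} C] [MonoidalCategory C] [SymmetricCategory C]
variable {D : Type u₂} [Category.{v} D] [MonoidalCategory D] [SymmetricCategory D]
variable (M : Type u₃) [Category.{v} M] [MonoidalLeftAction C M]
  [HasColimits M] [CocontinuousAction C M]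
variable (N : Type u₄) [Category.{v} N] [MonoidalLeftAction D N]
  [HasColimits N] [CocontinuousAction D N]
variable {B : C ⥤ D} [B.Braided] {A : D ⥤ C} (adj : B ⊣ A)

/-- Precomposition with `A` is left adjoint to precomposition with `B`. -/
noncomputable def presheafAdjunction :
    (Functor.whiskeringLeft _ _ (Type (max u₁ u₂ v))).obj (Aop adj).op ⊣
      (Functor.whiskeringLeft _ _ (Type (max u₁ u₂ v))).obj (Bop B).op :=
  (affAdjunction adj).op.whiskerLeft _

lemma presheafAdjunction_homEquiv_symm_app {F : (Aff C)ᵒᵖ ⥤ Type (max u₁ u₂ v)}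
    {G : (Aff D)ᵒᵖ ⥤ Type (max u₁ u₂ v)}
    (φ : F ⟶ ((Functor.whiskeringLeft _ _ (Type (max u₁ u₂ v))).obj (Bop B).op).obj G)
    (Z : Aff D) (s : F.obj (op ((Aop adj).obj Z))) :
    (((presheafAdjunction adj).homEquiv F G).symm φ).app (op Z) s =
      G.map ((affAdjunction adj).unit.app Z).op (φ.app (op ((Aop adj).obj Z)) s) := by
  rw [Adjunction.homEquiv_counit]
  rfl

variable [(Bop B).IsContinuous (spectralTopology C M) (spectralTopology D N)]

/-- The adjunction between categories of sheaves. -/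
noncomputable def sheafAdjunction : ATilde M N adj ⊣ BTilde M N B :=
  ((presheafAdjunction adj).comp (sheafificationAdjunction (spectralTopology D N) _)).restrictFullyFaithful
    (fullyFaithfulSheafToPresheaf (spectralTopology C M) _) (Functor.FullyFaithful.id _)
    (Iso.refl _) (Iso.refl _)

variable {M N} in
lemma isIso_homEquiv_symm {F : Sh.{u₂} C M} {G : Sh.{u₁} D N} (φ : F ⟶ (BTilde M N B).obj G)
    (h : IsIso (((presheafAdjunction adj).homEquiv _ _).symm φ.hom)) :
    IsIso (((sheafAdjunction M N adj).homEquiv F G).symm φ) :=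
  isIso_restrictFullyFaithful_homEquiv_symm (U := ATilde M N adj) (V := BTilde M N B) 
    (presheafAdjunction adj) (sheafificationAdjunction (spectralTopology D N) _)
    (fullyFaithfulSheafToPresheaf (spectralTopology C M) _) (Iso.refl _) (Iso.refl _) φ
    (by rw [Iso.refl_inv, NatTrans.id_app]; exact (congrArg IsIso (congrArg _ (Category.comp_id _))).mpr h)

variable {M N} in
-- Before sheafification the map is, over each `Z`, the bijection `Hom(A^op Z, X) ≅ Hom(Z, B^op X)`
-- of the adjunction on affine schemes.
lemma isIso_affineUnit [IsSubcanonical C M] [IsSubcanonical D N] (X : Aff C) :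
    IsIso (((sheafAdjunction M N adj).homEquiv _ _).symm (affineUnit M N B X)) := by
  apply isIso_homEquiv_symm
  rw [NatTrans.isIso_iff_isIso_app]
  intro Z
  rw [isIso_iff_bijective]
  have e (f : (Aop adj).obj Z.unop ⟶ X) :
      (((presheafAdjunction adj).homEquiv _
        ((affine.{u₁} N).obj ((Bop B).obj X)).obj).symm (affineUnit M N B X).hom).app Z (ULift.up f) =
        ULift.up ((affAdjunction adj).homEquiv _ _ f) := by
    refine (presheafAdjunction_homEquiv_symm_app adj (affineUnit M N B X).hom Z.unop (ULift.up f)).trans ?_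
    rw [Adjunction.homEquiv_unit]
    rfl
  refine Function.bijective_iff_has_inverse.2 ⟨fun g => ULift.up (((affAdjunction adj).homEquiv _ _).symm g.down), fun f => ?_, fun g => ?_⟩
  · obtain ⟨f⟩ := f
    exact (congrArg (fun g => ULift.up (((affAdjunction adj).homEquiv _ _).symm (ULift.down g))) (e f)).trans
      (congrArg ULift.up (Equiv.symm_apply_apply _ _))
  · exact (e _).trans (congrArg ULift.up (Equiv.apply_symm_apply _ _))

end Comparison

/-! ### Left exact left adjoints preserve schemes -/

section Schemes

/-- Transposition moves the question to `S`, where the family is jointly epimorphic. -/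
lemma hom_ext_of_isLeftAdjoint {S : Type*} [Category S] {S' : Type*} [Category S'] (T : S ⥤ S')
    [T.IsLeftAdjoint] {I : Type*} {F : S} {X : I → S} {f : ∀ i, X i ⟶ F}
    (h : ∀ {H : S} (u v : F ⟶ H), (∀ i, f i ≫ u = f i ≫ v) → u = v) {H : S'} (u v : T.obj F ⟶ H)
    (huv : ∀ i, T.map (f i) ≫ u = T.map (f i) ≫ v) : u = v := by
  apply ((Adjunction.ofIsLeftAdjoint T).homEquiv _ _).injective
  refine h _ _ fun i => ?_
  rw [← Adjunction.homEquiv_naturality_left, ← Adjunction.homEquiv_naturality_left, huv]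

variable {C : Type u₁} [Category.{v} C] [MonoidalCategory C] [BraidedCategory C]
variable {D : Type u₂} [Category.{v} D] [MonoidalCategory D] [SymmetricCategory D]
variable {M : Type u₃} [Category.{v} M] [MonoidalLeftAction C M]
  [HasColimits M] [CocontinuousAction C M] [IsSubcanonical C M]
variable {N : Type u₄} [Category.{v} N] [MonoidalLeftAction D N]
  [HasColimits N] [CocontinuousAction D N] [IsSubcanonical D N]
variable {K : Aff C ⥤ Aff D} {T : Sh.{u₂} C M ⥤ Sh.{u₁} D N}
  (e : affine.{u₂} M ⋙ T ≅ K ⋙ affine.{u₁} N)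
  (hK : ∀ {X Y : Aff C} {f : Y ⟶ X}, IsSpectralImmersion M f → IsSpectralImmersion N (K.map f))

/-- The image under `T` of a morphism from an affine scheme, as a morphism from an affine scheme. -/
noncomputable def mapAffine {X : Aff C} {F : Sh.{u₂} C M} (f : (affine.{u₂} M).obj X ⟶ F) :
    (affine.{u₁} N).obj (K.obj X) ⟶ T.obj F :=
  e.inv.app X ≫ T.map f

lemma map_mapAffine {X Y : Aff C} {F : Sh.{u₂} C M} (z : Y ⟶ X) (f : (affine.{u₂} M).obj X ⟶ F) :
    (affine.{u₁} N).map (K.map z) ≫ mapAffine e f = mapAffine e ((affine M).map z ≫ f) := by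
  have h := e.inv.naturality z
  rw [mapAffine, mapAffine, T.map_comp]
  exact (Category.assoc _ _ _).symm.trans ((h =≫ T.map f).trans (Category.assoc _ _ _))

lemma mapAffine_comp {X : Aff C} {F G : Sh.{u₂} C M} (f : (affine.{u₂} M).obj X ⟶ F) (g : F ⟶ G) :
    mapAffine e f ≫ T.map g = mapAffine e (f ≫ g) := by
  rw [mapAffine, mapAffine, T.map_comp, Category.assoc]

lemma mapAffine_eq {X : Aff C} {F : Sh.{u₂} C M} (f : (affine.{u₂} M).obj X ⟶ F) :
    T.map f = e.hom.app X ≫ mapAffine e f :=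
  (e.hom_inv_id_app_assoc X _).symm

variable [MonoidalClosed D] [HasColimits D] [HasFiniteLimits N]

include hK in
/-- A left exact left adjoint that extends a functor between affine schemes which preserves spectral
immersions takes a Zariski open immersion in an affine cover to one. -/
lemma IsZariskiOpenImmersion.mapAffine [PreservesFiniteLimits T] [T.IsLeftAdjoint] {I : Type t}
    {F : Sh.{u₂} C M} {X : I → Aff C} {f : ∀ i, (affine.{u₂} M).obj (X i) ⟶ F}
    (hf : ∀ i, IsZariskiOpenImmersion (f i))
    (h : ∀ {H : Sh.{u₁} D N} (u v : T.obj F ⟶ H),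
      (∀ i, RelativeScheme.mapAffine e (f i) ≫ u = RelativeScheme.mapAffine e (f i) ≫ v) → u = v) (i : I) :
    IsZariskiOpenImmersion (RelativeScheme.mapAffine e (f i)) := by
  intro X' g
  have := (hf i).mono
  have : Mono (RelativeScheme.mapAffine e (f i)) := mono_comp _ _
  refine ⟨inferInstance, isZariskiOpen_mk _ fun {Y} s b hs => ?_⟩
  -- The map `g` lifts locally to the affine cover of `T.obj F`. The lifts may be taken on spectral
  -- immersions `v : V ⟶ X'`, and this cover is pulled back to `Y` along `b`.
  refine (spectralTopology D N).transitive
    ((spectralTopology D N).pullback_stable b (spectralPart_mem (factorSieve_mem h g))) _ ?_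
  rintro Z c ⟨V, k, v, hv, ⟨j, q', hq'⟩, hk⟩
  obtain ⟨q, rfl⟩ := (affine.{u₁} N).map_surjective q'
  -- On `V` the map `g` factors through `K X_j`, so openness of `X_i ×_F X_j` in `X_j`, a statement
  -- over `C`, becomes available. Its cover consists of spectral immersions `z m` into `X_j` with
  -- lifts `l m`.
  obtain ⟨_, hj⟩ := hf i (X j) (f j)
  obtain ⟨I', Y', z, l, hz, hl, hepi⟩ := hj.exists_cover
  have sq := (IsPullback.of_hasPullback (f i) (f j)).map T
  -- Over `Z` the section `s` gives a point of `T X_i` and the lift `q` a point of `T X_j`, with the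
  -- same image in `T F`. Since `T` preserves pullbacks, they define a point of `T (X_i ×_F X_j)`.
  have w : ((affine N).map c ≫ s ≫ pullback.fst _ _ ≫ e.inv.app (X i)) ≫ T.map (f i) =
      ((affine N).map (k ≫ q) ≫ e.inv.app (X j)) ≫ T.map (f j) := by
    have h1 : ((affine N).map (k ≫ q) ≫ e.inv.app (X j)) ≫ T.map (f j) =
        (affine N).map (c ≫ b) ≫ g := by
      rw [Functor.map_comp, Category.assoc, Category.assoc, ← hk, Functor.map_comp, Category.assoc,
        ← hq']
      rfl
    rw [h1, Functor.map_comp, ← hs]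
    simp only [Category.assoc]
    rw [← pullback.condition]
    rfl
  -- Being a left adjoint, `T` keeps the family `l` jointly epimorphic, so this point lifts locally
  -- to some `T (Y' m)`.
  refine (spectralTopology D N).superset_covering ?_
    (factorSieve_mem (hom_ext_of_isLeftAdjoint T hepi) (sq.lift _ _ w))
  rintro Z' d ⟨m, r, hr⟩
  obtain ⟨r', hr'⟩ := (affine.{u₁} N).map_surjective (r ≫ e.hom.app (Y' m))
  -- The immersion required by the criterion is `P ⟶ V ⟶ X'`, where `P` is the base change of `K (Y'
  -- m) ⟶ K X_j` along `q`.
  obtain ⟨P, p₁, p₂, sq', hp₂⟩ := (hK (hz m)).exists_isPullback q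
  have w' : r' ≫ K.map (z m) = (d ≫ k) ≫ q := by
    apply (affine.{u₁} N).map_injective
    have h1 : e.inv.app (X j) ≫ e.hom.app (X j) = 𝟙 ((affine.{u₁} N).obj (K.obj (X j))) :=
      e.inv_hom_id_app _
    have h2 : r ≫ T.map (l m) = (affine N).map d ≫ sq.lift _ _ w := hr
    have h3 : T.map ((affine M).map (z m)) = T.map (l m) ≫ T.map (pullback.snd (f i) (f j)) := by
      rw [← T.map_comp, hl]
    have h4 : e.hom.app (Y' m) ≫ (affine N).map (K.map (z m)) =
        T.map ((affine M).map (z m)) ≫ e.hom.app (X j) :=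
      (e.hom.naturality (z m)).symm
    rw [Functor.map_comp, hr', Category.assoc, h4, h3, Category.assoc, reassoc_of% h2, sq.lift_snd_assoc,
      Category.assoc, h1, Category.comp_id, Category.assoc, ← Functor.map_comp]
  refine ⟨P, sq'.lift r' (d ≫ k) w', p₂ ≫ v,
    pullback.lift ((affine N).map p₁ ≫ RelativeScheme.mapAffine e (l m ≫ pullback.fst _ _) ≫ e.hom.app (X i))
      ((affine N).map (p₂ ≫ v)) ?_, hp₂.comp hv, pullback.lift_snd _ _ _, ?_⟩
  · have h1 : e.hom.app (X i) ≫ RelativeScheme.mapAffine e (f i) = T.map (f i) :=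
      (mapAffine_eq e (f i)).symm
    rw [Category.assoc, Category.assoc, h1, mapAffine_comp, Category.assoc, pullback.condition,
      reassoc_of% (hl m), ← map_mapAffine, ← Functor.map_comp_assoc, sq'.w, Functor.map_comp,
      Category.assoc, Functor.map_comp, Category.assoc]
    exact congrArg _ hq'
  · rw [sq'.lift_snd_assoc, Category.assoc, hk, Category.assoc]

include e hK in
/-- A left exact left adjoint that extends a functor between affine schemes which preserves spectral
immersions takes schemes to schemes. -/
lemma IsScheme.map [PreservesFiniteLimits T] [T.IsLeftAdjoint] {F : Sh.{u₂} C M} (hF : IsScheme F) :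
    IsScheme (T.obj F) := by
  obtain ⟨I, X, f, hf, hepi⟩ := hF
  -- Both categories of sheaves take values in sets of the same universe, so one index type serves
  -- for the cover and for its image.
  have : HasColimitsOfShape (Discrete I) (Sh.{u₂} C M) := Sheaf.instHasColimitsOfShape
  have : HasColimitsOfShape (Discrete I) (Sh.{u₁} D N) := Sheaf.instHasColimitsOfShape
  have h {H : Sh.{u₁} D N} (u v : T.obj F ⟶ H)
      (huv : ∀ i, mapAffine e (f i) ≫ u = mapAffine e (f i) ≫ v) : u = v := by
    refine hom_ext_of_isLeftAdjoint T ((epi_sigmaDesc_iff f).1 hepi) u v fun i => ?_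
    rw [mapAffine_eq e, Category.assoc, huv, Category.assoc]
  exact ⟨I, fun i => K.obj (X i), fun i => mapAffine e (f i),
    fun i => IsZariskiOpenImmersion.mapAffine e hK hf h i, (epi_sigmaDesc_iff _).2 h⟩

end Schemes

/-! ### Exactness of the comparison functor and its extension of `B^op` -/

section Comparison

variable {C : Type u₁} [Category.{v} C] [MonoidalCategory C] [SymmetricCategory C]
variable {D : Type u₂} [Category.{v} D] [MonoidalCategory D] [SymmetricCategory D]
variable (M : Type u₃) [Category.{v} M] [MonoidalLeftAction C M]
  [HasColimits M] [CocontinuousAction C M]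
variable (N : Type u₄) [Category.{v} N] [MonoidalLeftAction D N]
  [HasColimits N] [CocontinuousAction D N]
variable {B : C ⥤ D} [B.Braided] {A : D ⥤ C} (adj : B ⊣ A)

/-- Limits of presheaves are pointwise, so precomposition preserves them, and sheafification is left
exact. No exactness of `A` itself is involved. -/
instance : PreservesFiniteLimits (ATilde M N adj) :=
  have : PreservesFiniteLimits ((Functor.whiskeringLeft _ _ (Type (max u₁ u₂ v))).obj (Aop adj).op) :=
    ⟨fun _ => inferInstance⟩
  comp_preservesFiniteLimits _ _

variable [(Bop B).IsContinuous (spectralTopology C M) (spectralTopology D N)]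
  [IsSubcanonical C M] [IsSubcanonical D N]

/-- The comparison functor on sheaves extends `B^op` on affine schemes. -/
noncomputable def affineIso : affine.{u₂} M ⋙ ATilde M N adj ≅ Bop B ⋙ affine.{u₁} N :=
  NatIso.ofComponents
    (fun X =>
      @asIso _ _ _ _ (((sheafAdjunction M N adj).homEquiv _ _).symm (affineUnit M N B X))
        (isIso_affineUnit adj X))
    (fun {X Y} f => by
      have h : (affine.{u₂} M).map f ≫ affineUnit M N B Y =
          affineUnit M N B X ≫ (BTilde M N B).map ((affine.{u₁} N).map ((Bop B).map f)) := by
        ext Z g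
        exact congrArg ULift.up ((Bop B).map_comp g.down f)
      exact ((sheafAdjunction M N adj).homEquiv_naturality_left_symm _ _).symm.trans
        ((congrArg _ h).trans ((sheafAdjunction M N adj).homEquiv_naturality_right_symm _ _)))

end Comparison

end RelativeScheme

theorem mainTheorem4
    {C : Type u₁} [Category.{v} C] [MonoidalCategory C] [SymmetricCategory C] [MonoidalClosed C]
    [HasLimits C] [HasColimits C]
    {D : Type u₂} [Category.{v} D] [MonoidalCategory D] [SymmetricCategory D] [MonoidalClosed D]
    [HasLimits D] [HasColimits D]
    {M : Type u₃} [Category.{v} M] [MonoidalLeftAction C M] [CocontinuousAction C M]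
    [HasLimits M] [HasColimits M]
    {N : Type u₄} [Category.{v} N] [MonoidalLeftAction D N] [CocontinuousAction D N]
    [HasLimits N] [HasColimits N]
    (B : C ⥤ D) [B.Braided] (A : D ⥤ C) (adj : B ⊣ A) [PreservesFilteredColimits A]
    (L : N ⥤ M) [LaxLinearAlong B L] [L.ReflectsIsomorphisms] [PreservesFiniteLimits L]
    (hθ : ∀ {a b : CommMon C} (α : a ⟶ b), IsFlat M α →
      ∀ n : Mod N (B.mapCommMon.obj a).X, IsIso (theta B L α n)) :
    (∀ {I : Type t} {X : Aff C} (Y : I → Aff C) (f : ∀ i, Y i ⟶ X), IsFpqcCover M Y f →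
      IsFpqcCover N (fun i => (Bop B).obj (Y i)) (fun i => (Bop B).map (f i))) ∧
    ∃ (_ : (Bop B).IsContinuous (spectralTopology C M) (spectralTopology D N))
      (adj' : ATilde M N adj ⊣ BTilde M N B),
      ∀ [IsSubcanonical C M] [IsSubcanonical D N],
        (∀ F : Sh.{u₂} C M, IsScheme F → IsScheme ((ATilde M N adj).obj F)) ∧
        ∀ X : Aff C, IsIso ((adj'.homEquiv _ _).symm (affineUnit M N B X)) := by
  refine ⟨fun Y f hf => hf.map B L hθ, isContinuous_Bop adj L hθ, ?_⟩
  have := isContinuous_Bop adj L hθ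
  have := (sheafAdjunction M N adj).isLeftAdjoint
  exact ⟨sheafAdjunction M N adj, fun {_ _} =>
    ⟨fun F hF => hF.map (affineIso M N adj) fun hf => hf.map adj L hθ, fun X => isIso_affineUnit adj X⟩⟩
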